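/- Let $a$ be a positive integer. For integers $g \ge 0$, $n \ge 1$ and a tuple of positive integers $\boldsymbol{\mu} = (\mu_1,\ldots,\mu_n)$ with sum $|\boldsymbol{\mu}|$, let the monotone orbifold Hurwitz number $\vec H^{[a]}_{g,n}(\boldsymbol{\mu})$ be $\frac{1}{|\boldsymbol{\mu}|!}$ times the number of tuples $(\sigma_0,\sigma_1,\ldots,\sigma_m)$ of permutations in $S_{|\boldsymbol{\mu}|}$, each taken together with a labelling of the cycles (including fixed points) of $\sigma_0\sigma_1\cdots\sigma_m$ by $1,\ldots,n$, such that (i) $m = 2g-2+n+\frac{|\boldsymbol{\mu}|}{a}$; (ii) $\sigma_0$ has cycle type $(a,a,\ldots,a)$, and $\sigma_1,\ldots,\sigma_m$ is a monotone sequence of transpositions, i.e. $\sigma_i = (r_i\ s_i)$ with $r_i<s_i$ and $s_1\le s_2\le\cdots\le s_m$; (iii) the cycle of $\sigma_0\sigma_1\cdots\sigma_m$ labelled $i$ has length $\mu_i$ for $i=1,\ldots,n$; (iv) $\sigma_0,\sigma_1,\ldots,\sigma_m$ generate a transitive subgroup of $S_{|\boldsymbol{\mu}|}$. Let $$\vec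 F^{[a]}_{g,n}(x_1,\ldots,x_n) = \sum_{\mu_1,\ldots,\mu_n=1}^\infty \vec H^{[a]}_{g,n}(\mu_1,\ldots,\mu_n)\prod_{i=1}^n x_i^{\mu_i}, \qquad \vec Z^{[a]}(x,\hbar) = \exp\left[\sum_{g=0}^\infty\sum_{n=1}^\infty \frac{\hbar^{2g-2+n}}{n!}\,\vec F^{[a]}_{g,n}(x,\ldots,x)\right],$$ where $\vec Z^{[a]}(x,\hbar)$ is regarded as an element of $\mathbb{Q}(\!(\hbar)\!)[[x]]$, i.e. a formal power series in $x$ whose coefficients are formal Laurent series in $\hbar$. Then $$\vec Z^{[a]}(x,\hbar) = 1+\sum_{k=1}^\infty \frac{x^{ak}}{k!\,a^k\,\hbar^k}\prod_{j=1}^{ak-1}\frac{1}{1-j\hbar}.$$ Furthermore, with $\widehat x = x$ (multiplication by $x$) and $\widehat y = -\hbar\frac{\partial}{\partial x}$, $$\left[\widehat x^{\,a-1}+\prod_{j=0}^{a-1}(1+\widehat x\,\widehat y+j\hbar)\,\widehat y\right]\vec Z^{[a]}(x,\hbar)=0.$$ -/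

import Mathlib

noncomputable section

namespace MonotoneOrbifold

/-- A list of permutations of `{1, …, d}` (modelled by `Fin d`) is a monotone sequence of
transpositions `(r₁ s₁), …, (r_m s_m)` if `r_i < s_i` for all `i` and `s₁ ≤ ⋯ ≤ s_m`. -/
def IsMonotoneTranspositions {d : ℕ} (τ : List (Equiv.Perm (Fin d))) : Prop :=
  ∃ rs : List (Fin d × Fin d),
    τ = rs.map (fun p => Equiv.swap p.1 p.2) ∧
    (∀ p ∈ rs, p.1 < p.2) ∧
    rs.Pairwise (fun p q => p.2 ≤ q.2)

/-- Monotone `a`-orbifold Hurwitz factorisations `(σ₀, σ₁, …, σ_m)` of type `(g, μ)`,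
`μ = (μ₁, …, μ_n)`, in the symmetric group of degree `|μ| = ∑ i, μ i`. The list `σ` is
`(σ₁, …, σ_m)`. The labelling of the cycles (fixed points included) of `σ₀ σ₁ ⋯ σ_m` by
`1, …, n` is part of the data. -/
structure Factorisation (a g : ℕ) {n : ℕ} (μ : Fin n → ℕ) where
  σ₀ : Equiv.Perm (Fin (∑ i, μ i))
  σ : List (Equiv.Perm (Fin (∑ i, μ i)))
  /-- the labelling of the cycles of `σ₀ σ₁ ⋯ σ_m` -/
  label : Quotient (Equiv.Perm.SameCycle.setoid (σ₀ * σ.prod)) ≃ Fin n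
  /-- `m = 2g - 2 + n + |μ| / a` -/
  length_eq : (σ.length : ℚ) = 2 * g - 2 + n + ((∑ i, μ i : ℕ) : ℚ) / a
  /-- all cycles of `σ₀` have length `a` (`partition` counts fixed points as cycles) -/
  cycleType_eq : ∀ c ∈ σ₀.partition.parts, c = a
  monotone : IsMonotoneTranspositions σ
  /-- the cycle with label `i` has length `μ i` -/
  label_card : ∀ i, Nat.card {y : Fin (∑ i, μ i) // label (Quotient.mk _ y) = i} = μ i
  transitive : MulAction.IsPretransitive
    (Subgroup.closure ({σ₀} ∪ {t | t ∈ σ})) (Fin (∑ i, μ i))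

/-- The monotone orbifold Hurwitz number of genus `g` with ramification `μ` over `∞`. -/
def hurwitz (a g : ℕ) {n : ℕ} (μ : Fin n → ℕ) : ℚ :=
  1 / (Nat.factorial (∑ i, μ i) : ℚ) * (Nat.card (Factorisation a g μ) : ℚ)

/-- The free energy `F_{g,n}(x₁, …, x_n) = ∑_{μ₁, …, μ_n ≥ 1} H_{g,n}(μ) x₁^{μ₁} ⋯ x_n^{μ_n}`. -/
def freeEnergy (a g n : ℕ) : MvPowerSeries (Fin n) ℚ :=
  fun μ => if ∀ i, 1 ≤ μ i then hurwitz a g (fun i => μ i) else 0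

/-- The diagonal specialisation `F_{g,n}(x, …, x)`. -/
def diagFreeEnergy (a g n : ℕ) : PowerSeries ℚ :=
  MvPowerSeries.subst (fun _ : Fin n => (PowerSeries.X : PowerSeries ℚ)) (freeEnergy a g n)

/-- The coefficient of `x^d` in `ħ^{2g-2+n} / n! * F_{g,n}(x, …, x)`, for all `g ≥ 0`, `n ≥ 1`,
as a summable family of Laurent series in `ħ`. -/
def exponentFamily (a d : ℕ) : HahnSeries.SummableFamily ℤ ℚ (ℕ × ℕ+) where
  toFun p := HahnSeries.single (2 * (p.1 : ℤ) - 2 + ((p.2 : ℕ) : ℤ))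
    (1 / (Nat.factorial p.2 : ℚ) * PowerSeries.coeff d (diagFreeEnergy a p.1 p.2))
  isPWO_iUnion_support' := by
    refine (BddBelow.isWF (s := _) ⟨-1, ?_⟩).isPWO
    intro r hr
    obtain ⟨p, hp⟩ := Set.mem_iUnion.1 hr
    have h := HahnSeries.support_single_subset hp
    have h2 := p.2.pos
    simp only [Set.mem_singleton_iff] at h
    omega
  finite_co_support' := by
    intro r
    have key : Set.InjOn (fun p : ℕ × ℕ+ => (p.1, (p.2 : ℕ)))
        {p : ℕ × ℕ+ | r = 2 * (p.1 : ℤ) - 2 + ((p.2 : ℕ) : ℤ)} := by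
      rintro ⟨g, n⟩ - ⟨g', n'⟩ - h
      simp only [Prod.mk.injEq, PNat.coe_inj] at h
      exact Prod.ext h.1 h.2
    refine Set.Finite.subset (Set.Finite.of_finite_image
      (Set.Finite.subset (Set.finite_Iic ((r + 2).toNat, (r + 2).toNat)) ?_) key) ?_
    · rintro _ ⟨p, hp, rfl⟩
      simp only [Set.mem_ofPred_eq] at hp
      simp only [Set.mem_Iic, Prod.mk_le_mk]
      omega
    · intro p hp
      by_contra hne
      exact hp (HahnSeries.coeff_single_of_ne hne)

/-- The exponent `∑_{g ≥ 0} ∑_{n ≥ 1} ħ^{2g-2+n} / n! * F_{g,n}(x, …, x)` of the wave function,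
a formal power series in `x` whose coefficients are Laurent series in `ħ`. -/
def exponent (a : ℕ) : PowerSeries (LaurentSeries ℚ) :=
  PowerSeries.mk fun d => (exponentFamily a d).hsum

/-- The wave function, the exponential of `exponent a`. -/
def waveFunction (a : ℕ) : PowerSeries (LaurentSeries ℚ) :=
  PowerSeries.subst (exponent a) (PowerSeries.exp (LaurentSeries ℚ))

/-- The formal variable `ħ`. -/
def hbar : LaurentSeries ℚ := HahnSeries.single 1 1

/-- Multiplication by `x`. -/
def xHat : Module.End (LaurentSeries ℚ) (PowerSeries (LaurentSeries ℚ)) :=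
  LinearMap.mulLeft (LaurentSeries ℚ) (PowerSeries.X : PowerSeries (LaurentSeries ℚ))

/-- The operator `-ħ ∂/∂x`. -/
def yHat : Module.End (LaurentSeries ℚ) (PowerSeries (LaurentSeries ℚ)) :=
  (-hbar) • (PowerSeries.derivative (LaurentSeries ℚ)).toLinearMap

/-- The operator `x̂^{a-1} + ∏_{j=0}^{a-1} (1 + x̂ ŷ + j ħ) ŷ`. The product is taken in the order
of increasing `j`, but its factors commute. -/
def quantumCurve (a : ℕ) : Module.End (LaurentSeries ℚ) (PowerSeries (LaurentSeries ℚ)) :=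
  xHat ^ (a - 1) +
    ((List.range a).map fun j : ℕ =>
      1 + xHat * yHat + ((j : LaurentSeries ℚ) * hbar) •
        (1 : Module.End (LaurentSeries ℚ) (PowerSeries (LaurentSeries ℚ)))).prod * yHat

end MonotoneOrbifold

end

/-!
The wave function is the generating series of monotone factorisations, connected or not, and these
can be counted outright: the permutation `σ₀` and the monotone sequence of transpositions are chosen
independently of each other. There are `(a k)! / (k! a ^ k)` permutations of degree `d = a k` all of
whose cycles have length `a`. A monotone sequence amounts to the choice, for every `s`, of a word in
the elements `r < s`, so that the sequences are counted by `∏ 1 / (1 - j ħ)` over `j < d`. Up to the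
normalisation `ħ ^ (-d / a) / d!` this is the coefficient of `x ^ d` in the closed formula.

Two facts connect this count with the definition of the wave function.

* The exponent is the generating series of the transitive factorisations (`coeff_exponent`). The
  labellings contribute a factor `n!`, and summation over `μ`, `n` and `g` removes all conditions on
  the product `σ₀ σ₁ ⋯ σ_m`, since every transitive factorisation has a genus which is a natural
  number. This is the Riemann–Hurwitz formula `exists_orbits_riemannHurwitz`, proved by multiplying
  with one transposition after the other: each joins or cuts cycles, and joins cycles whenever it
  joins orbits.
* The exponential of the connected series is the series of everything (`waveFunction_eq`). In
  terms of words, a factorisation is pasted from its restrictions to an orbit and to the complement,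
  because monotone sequences on disjoint sets interleave in exactly one way. Splitting off the orbit
  of one element gives a recursion (`card_monotoneData_succ`) that reads `Z' = F' Z` for generating
  series, which determines `Z` as the exponential of `F`.

The quantum curve acts diagonally up to a shift on monomials, and annihilates the wave function
because its `a` factors are the denominators by which consecutive coefficients of the closed formula
differ (`quantumCurve_waveFunction`).
-/

namespace MonotoneOrbifold

open Equiv
open Finset.HasAntidiagonal (antidiagonal mem_antidiagonal)

/-! ### Cycles of a permutation multiplied by a transposition -/

/-- The number of classes of a setoid. -/
noncomputable def numClasses {α : Type*} (S : Setoid α) : ℕ := Nat.card (Quotient S)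

/-- The smallest setoid above `S` in which `r` and `s` are equivalent: the class of `s` is
redirected to the class of `r`. -/
noncomputable def addEdge {α : Type*} (S : Setoid α) (r s : α) : Setoid α :=
  open Classical in
  Setoid.ker fun x => if S x s then Quotient.mk S r else Quotient.mk S x

section addEdge

variable {α : Type*} {S : Setoid α} {r s : α}

theorem le_addEdge : S ≤ addEdge S r s := by
  classical
  intro x y hxy
  change (if S x s then Quotient.mk S r else Quotient.mk S x) =
    if S y s then Quotient.mk S r else Quotient.mk S y
  have h : S x s ↔ S y s := ⟨fun h => S.trans (S.symm hxy) h, fun h => S.trans hxy h⟩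
  by_cases hx : S x s
  · rw [if_pos hx, if_pos (h.1 hx)]
  · rw [if_neg hx, if_neg (mt h.2 hx)]
    exact Quotient.sound hxy

theorem addEdge_rel : addEdge S r s r s := by
  classical
  change (if S r s then Quotient.mk S r else Quotient.mk S r) =
    if S s s then Quotient.mk S r else Quotient.mk S s
  rw [if_pos (S.refl s), ite_self]

theorem addEdge_le {T : Setoid α} (h : S ≤ T) (hrs : T r s) : addEdge S r s ≤ T := by
  classical
  intro x y hxy
  change (if S x s then Quotient.mk S r else Quotient.mk S x) =
    (if S y s then Quotient.mk S r else Quotient.mk S y) at hxy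
  split_ifs at hxy with h1 h2 h2
  · exact T.trans (h h1) (T.symm (h h2))
  · exact T.trans (h h1) (T.trans (T.symm hrs) (h (Quotient.exact hxy)))
  · exact T.trans (h (Quotient.exact hxy)) (T.trans hrs (T.symm (h h2)))
  · exact h (Quotient.exact hxy)

theorem addEdge_eq_self (h : S r s) : addEdge S r s = S :=
  le_antisymm (addEdge_le le_rfl h) le_addEdge

theorem numClasses_addEdge [Finite α] (h : ¬ S r s) :
    numClasses (addEdge S r s) + 1 = numClasses S := by
  classical
  have e : Quotient (addEdge S r s) ≃ {c : Quotient S // c ≠ Quotient.mk S s} := by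
    refine (Setoid.quotientKerEquivRange _).trans (Equiv.subtypeEquivRight fun c => ?_)
    refine Quotient.inductionOn c fun y => ?_
    constructor
    · rintro ⟨x, hx⟩
      simp only at hx
      split_ifs at hx with h1
      · rw [← hx]
        exact fun hh => h (Quotient.exact hh)
      · rw [← hx]
        exact fun hh => h1 (Quotient.exact hh)
    · intro hy
      exact ⟨y, if_neg fun hh => hy (Quotient.sound hh)⟩
  have := Fintype.ofFinite (Quotient S)
  have h2 := Fintype.card_subtype_compl (fun c : Quotient S => c = Quotient.mk S s)
  have h3 : 0 < Fintype.card (Quotient S) := Fintype.card_pos_iff.2 ⟨Quotient.mk S s⟩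
  rw [Fintype.card_subtype_eq] at h2
  unfold numClasses
  rw [Nat.card_congr e, Nat.card_eq_fintype_card, Nat.card_eq_fintype_card]
  change Fintype.card {c : Quotient S // ¬ c = Quotient.mk S s} + 1 = _
  omega

end addEdge

section swap

variable {α : Type*} {σ : Perm α} {r s : α}

theorem sameCycle_setoid_le_iff {T : Setoid α} :
    Perm.SameCycle.setoid σ ≤ T ↔ ∀ x, T x (σ x) := by
  constructor
  · intro h x
    exact h (Perm.sameCycle_apply_right.2 (Perm.SameCycle.refl σ x))
  · rintro h x y ⟨i, rfl⟩
    induction i with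
    | zero => simp
    | succ n ih =>
      rw [add_comm, zpow_add, zpow_one, Perm.mul_apply]
      exact T.trans ih (h _)
    | pred n ih =>
      refine T.trans ih (T.symm ?_)
      have := h ((σ ^ (-(n : ℤ) - 1)) x)
      rwa [← Perm.mul_apply, ← zpow_one_add, add_sub_cancel] at this

variable [DecidableEq α]

theorem sameCycle_setoid_mul_swap_le :
    Perm.SameCycle.setoid (σ * swap r s) ≤ addEdge (Perm.SameCycle.setoid σ) r s := by
  rw [sameCycle_setoid_le_iff]
  intro x
  set T := addEdge (Perm.SameCycle.setoid σ) r s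
  have h1 : ∀ x, T x (σ x) := sameCycle_setoid_le_iff.1 le_addEdge
  have h2 : T r s := addEdge_rel
  rw [Perm.mul_apply]
  refine T.trans ?_ (h1 _)
  rcases eq_or_ne x r with rfl | hr
  · rwa [swap_apply_left]
  rcases eq_or_ne x s with rfl | hs
  · rw [swap_apply_right]; exact T.symm h2
  · rw [swap_apply_of_ne_of_ne hr hs]

/-- Adding the edge `r s` to the cycles of `σ` or to those of `σ * swap r s` gives the same
partition. -/
theorem addEdge_mul_swap :
    addEdge (Perm.SameCycle.setoid (σ * swap r s)) r s =
      addEdge (Perm.SameCycle.setoid σ) r s := by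
  refine le_antisymm (addEdge_le sameCycle_setoid_mul_swap_le addEdge_rel)
    (addEdge_le ?_ addEdge_rel)
  have := sameCycle_setoid_mul_swap_le (σ := σ * swap r s) (r := r) (s := s)
  rwa [mul_assoc, swap_mul_self, mul_one] at this

/-- A transposition joins two distinct cycles: the cycle of `r` is run through from `s`. -/
theorem sameCycle_mul_swap_of_not_sameCycle [Finite α] (h : ¬ σ.SameCycle r s) :
    (σ * swap r s).SameCycle r s := by
  classical
  have hex : ∃ k, 0 < k ∧ (σ ^ k) r = r := by
    obtain ⟨k, hk, h⟩ := isOfFinOrder_iff_pow_eq_one.1 (isOfFinOrder_of_finite σ)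
    exact ⟨k, hk, by rw [h]; rfl⟩
  obtain ⟨hk, hkr⟩ := Nat.find_spec hex
  have hmin : ∀ {i}, i < Nat.find hex → ¬ (0 < i ∧ (σ ^ i) r = r) := fun h => Nat.find_min hex h
  set k := Nat.find hex
  have key : ∀ i, i < k → ((σ * swap r s) ^ (i + 1)) s = (σ ^ (i + 1)) r := by
    intro i
    induction i with
    | zero => intro _; simp
    | succ i ih =>
      intro hi
      rw [pow_succ', Perm.mul_apply, ih (by omega), Perm.mul_apply, swap_apply_of_ne_of_ne,
        pow_succ' σ (i + 1), Perm.mul_apply]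
      · exact fun hh => hmin hi ⟨by omega, hh⟩
      · intro hh
        exact h ⟨(i + 1 : ℕ), by rw [zpow_natCast]; exact hh⟩
  have h1 := key (k - 1) (by omega)
  rw [Nat.sub_add_cancel hk, hkr] at h1
  exact Perm.SameCycle.symm ⟨(k : ℕ), by rw [zpow_natCast]; exact h1⟩

/-- A transposition cuts a cycle that contains both of its points. -/
theorem not_sameCycle_mul_swap_of_sameCycle [Finite α] (hne : r ≠ s) (h : σ.SameCycle r s) :
    ¬ (σ * swap r s).SameCycle r s := by
  classical
  have hex : ∃ k, 0 < k ∧ (σ ^ k) s = r := by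
    obtain ⟨k, hk, -, h⟩ := h.symm.exists_pow_eq''
    exact ⟨k, hk, h⟩
  obtain ⟨hk, hkr⟩ := Nat.find_spec hex
  have hmin : ∀ {i}, i < Nat.find hex → ¬ (0 < i ∧ (σ ^ i) s = r) := fun h => Nat.find_min hex h
  set k := Nat.find hex
  -- up to the first visit to `r`, the `σ`-orbit of `s` does not return to `s`
  have hs : ∀ i, 0 < i → i ≤ k → (σ ^ i) s ≠ s := by
    intro i hi hik his
    rcases hik.eq_or_lt with rfl | hik
    · exact hne (hkr.symm.trans his)
    · refine hmin (i := k - i) (by omega) ⟨by omega, ?_⟩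
      rw [← hkr]
      conv_rhs => rw [← Nat.sub_add_cancel hik.le, pow_add, Perm.mul_apply, his]
  have key : ∀ i, i < k → ((σ * swap r s) ^ (i + 1)) r = (σ ^ (i + 1)) s := by
    intro i
    induction i with
    | zero => intro _; simp
    | succ i ih =>
      intro hi
      rw [pow_succ', Perm.mul_apply, ih (by omega), Perm.mul_apply, swap_apply_of_ne_of_ne,
        pow_succ' σ (i + 1), Perm.mul_apply]
      · exact fun hh => hmin hi ⟨by omega, hh⟩
      · exact hs _ (by omega) (by omega)
  have hper : ((σ * swap r s) ^ k) r = r := by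
    have := key (k - 1) (by omega)
    rwa [Nat.sub_add_cancel hk, hkr] at this
  rintro hcyc
  obtain ⟨j, -, hj⟩ := hcyc.exists_pow_eq'
  have hj2 : ((σ * swap r s) ^ (j % k)) r = s := by
    have : ∀ n : ℕ, (((σ * swap r s) ^ k) ^ n) r = r := fun n => by
      rw [← Perm.iterate_eq_pow]
      exact Function.iterate_fixed hper n
    rwa [← Nat.mod_add_div j k, pow_add, Perm.mul_apply, pow_mul, this] at hj
  have hlt := Nat.mod_lt j hk
  rcases Nat.eq_zero_or_pos (j % k) with h0 | h0
  · rw [h0] at hj2; exact hne hj2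
  · have := key (j % k - 1) (by omega)
    rw [Nat.sub_add_cancel h0, hj2] at this
    exact hs _ h0 hlt.le this.symm

theorem numClasses_mul_swap_of_not_sameCycle [Finite α] (h : ¬ σ.SameCycle r s) :
    numClasses (Perm.SameCycle.setoid (σ * swap r s)) + 1 =
      numClasses (Perm.SameCycle.setoid σ) := by
  rw [← numClasses_addEdge (S := Perm.SameCycle.setoid σ) h, ← addEdge_mul_swap,
    addEdge_eq_self (sameCycle_mul_swap_of_not_sameCycle h)]

theorem numClasses_mul_swap_of_sameCycle [Finite α] (hne : r ≠ s) (h : σ.SameCycle r s) :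
    numClasses (Perm.SameCycle.setoid (σ * swap r s)) =
      numClasses (Perm.SameCycle.setoid σ) + 1 := by
  rw [← numClasses_addEdge (S := Perm.SameCycle.setoid (σ * swap r s))
    (not_sameCycle_mul_swap_of_sameCycle hne h), addEdge_mul_swap,
    addEdge_eq_self (S := Perm.SameCycle.setoid σ) h]

/-- The Riemann–Hurwitz formula with its two consequences, integrality and non-negativity of the
genus, for possibly disconnected covers: `O` is the partition into orbits of the group generated
by `σ₀` and the transpositions. -/
theorem exists_orbits_riemannHurwitz [Finite α] (σ₀ : Perm α) (rs : List (α × α))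
    (hrs : ∀ p ∈ rs, p.1 ≠ p.2) :
    ∃ O : Setoid α, (∀ x, O x (σ₀ x)) ∧ (∀ p ∈ rs, O p.1 p.2) ∧
      Perm.SameCycle.setoid (σ₀ * (rs.map fun p => swap p.1 p.2).prod) ≤ O ∧
      ∃ g : ℕ, numClasses (Perm.SameCycle.setoid σ₀) +
        numClasses (Perm.SameCycle.setoid (σ₀ * (rs.map fun p => swap p.1 p.2).prod)) + 2 * g =
        2 * numClasses O + rs.length := by
  induction rs using List.reverseRecOn with
  | nil =>
    refine ⟨Perm.SameCycle.setoid σ₀, sameCycle_setoid_le_iff.1 le_rfl, by simp, ?_, 0, ?_⟩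
    · simp
    · simp [two_mul]
  | append_singleton rs p ih =>
    obtain ⟨O, hσ, hO, hle, g, hg⟩ := ih fun p hp => hrs p (by simp [hp])
    have hp := hrs p (by simp)
    rw [List.map_append, List.prod_append, List.map_singleton, List.prod_singleton, ← mul_assoc]
    set π := σ₀ * (rs.map fun p => swap p.1 p.2).prod
    refine ⟨addEdge O p.1 p.2, fun x => le_addEdge (hσ x), fun q hq => ?_, ?_, ?_⟩
    · rcases List.mem_append.1 hq with hq | hq
      · exact le_addEdge (hO q hq)
      · rw [List.mem_singleton.1 hq]
        exact addEdge_rel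
    · exact sameCycle_setoid_mul_swap_le.trans (addEdge_le (hle.trans le_addEdge) addEdge_rel)
    rw [List.length_append, List.length_singleton]
    by_cases hp' : O p.1 p.2
    · rw [addEdge_eq_self hp']
      by_cases hc : π.SameCycle p.1 p.2
      · have := numClasses_mul_swap_of_sameCycle hp hc
        exact ⟨g, by omega⟩
      · have := numClasses_mul_swap_of_not_sameCycle hc
        exact ⟨g + 1, by omega⟩
    · have h1 := numClasses_addEdge hp'
      have h2 := numClasses_mul_swap_of_not_sameCycle (σ := π) fun hc => hp' (hle hc)
      exact ⟨g, by omega⟩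

end swap

/-! ### Permutations all of whose cycles have the same length -/

/-- Every cycle of `σ`, fixed points included, has length `a`. -/
def UniformCycles {α : Type*} (a : ℕ) (σ : Perm α) : Prop :=
  ∀ x, Nat.card {y // σ.SameCycle x y} = a

theorem numClasses_mul_of_uniformCycles {α : Type*} [Finite α] {a : ℕ} {σ : Perm α}
    (h : UniformCycles a σ) : numClasses (Perm.SameCycle.setoid σ) * a = Nat.card α := by
  have := Fintype.ofFinite (Quotient (Perm.SameCycle.setoid σ))
  rw [← Nat.card_congr (Equiv.sigmaFiberEquiv (Quotient.mk (Perm.SameCycle.setoid σ))),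
    Nat.card_sigma, numClasses, Nat.card_eq_fintype_card, ← smul_eq_mul, ← Finset.card_univ,
    ← Finset.sum_const]
  refine Finset.sum_congr rfl fun c _ => ?_
  induction c using Quotient.inductionOn with
  | h x =>
    rw [← h x]
    exact Nat.card_congr (Equiv.subtypeEquivRight fun y =>
      (Quotient.eq.trans Perm.sameCycle_comm).symm)

theorem uniformCycles_conj {α β : Type*} {a : ℕ} {σ : Perm α} (e : α ≃ β) :
    UniformCycles a (e.permCongr σ) ↔ UniformCycles a σ := by
  have key : ∀ x y, (e.permCongr σ).SameCycle (e x) (e y) ↔ σ.SameCycle x y := by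
    intro x y
    have hz : ∀ i : ℤ, (e.permCongr σ) ^ i = e.permCongr (σ ^ i) := fun i =>
      (map_zpow e.permCongrHom σ i).symm
    exact exists_congr fun i => by rw [hz]; simp
  have hc : ∀ x, Nat.card {y // (e.permCongr σ).SameCycle (e x) y} =
      Nat.card {y // σ.SameCycle x y} := fun x =>
    (Nat.card_congr (e.subtypeEquiv fun y => (key x y).symm)).symm
  rw [UniformCycles, e.surjective.forall]
  exact forall_congr' fun x => by rw [hc]

theorem uniformCycles_one_iff {α : Type*} {σ : Perm α} : UniformCycles 1 σ ↔ σ = 1 := by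
  constructor
  · intro h
    ext x
    have := (Nat.card_eq_one_iff_unique.1 (h x)).1
    have := congrArg Subtype.val
      (Subsingleton.elim (α := {y // σ.SameCycle x y}) ⟨x, Perm.SameCycle.refl σ x⟩
        ⟨σ x, Perm.sameCycle_apply_right.2 (Perm.SameCycle.refl σ x)⟩)
    exact this.symm
  · rintro rfl x
    simp [Perm.sameCycle_one]

section Fintype

variable {α : Type*} [Fintype α] [DecidableEq α] {a : ℕ} {σ : Perm α}

theorem mem_parts_partition_iff {c : ℕ} :
    c ∈ σ.partition.parts ↔ ∃ x, Nat.card {y // σ.SameCycle x y} = c := by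
  have h1 : ∀ x ∈ σ.support, Nat.card {y // σ.SameCycle x y} = (σ.cycleOf x).support.card := by
    intro x hx
    rw [Nat.card_eq_fintype_card, ← Fintype.card_coe]
    exact Fintype.card_congr (Equiv.subtypeEquivRight fun y => by
      rw [Perm.mem_support_cycleOf_iff, and_iff_left hx])
  have h2 : ∀ x ∉ σ.support, Nat.card {y // σ.SameCycle x y} = 1 := by
    intro x hx
    have hfix : Function.IsFixedPt σ x := Perm.notMem_support.1 hx
    have : {y // σ.SameCycle x y} ≃ {y // y = x} := Equiv.subtypeEquivRight fun y =>
      ⟨fun ⟨i, hi⟩ => hi.symm.trans (hfix.perm_zpow i), fun h => h ▸ Perm.SameCycle.refl σ x⟩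
    rw [Nat.card_congr this]
    simp
  rw [Perm.parts_partition, Multiset.mem_add, Perm.cycleType_def, Multiset.mem_map,
    Multiset.mem_replicate]
  constructor
  · rintro (⟨τ, hτ, rfl⟩ | ⟨hne, rfl⟩)
    · have hτ' : τ ∈ σ.cycleFactorsFinset := hτ
      obtain ⟨x, hx⟩ := (Perm.mem_cycleFactorsFinset_iff.1 hτ').1.nonempty_support
      have := Perm.cycle_is_cycleOf hx hτ'
      refine ⟨x, ?_⟩
      rw [h1 x (Perm.mem_cycleFactorsFinset_support_le hτ' hx), this]
      simp
    · have : ∃ x, x ∉ σ.support := by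
        by_contra! hall
        rw [Finset.eq_univ_iff_forall.2 hall, Finset.card_univ] at hne
        omega
      obtain ⟨x, hx⟩ := this
      exact ⟨x, h2 x hx⟩
  · rintro ⟨x, rfl⟩
    by_cases hx : x ∈ σ.support
    · exact Or.inl ⟨σ.cycleOf x, Perm.cycleOf_mem_cycleFactorsFinset_iff.2 hx, (h1 x hx).symm⟩
    · refine Or.inr ⟨?_, h2 x hx⟩
      have := Finset.card_lt_univ_of_notMem hx
      omega

theorem forall_parts_partition_iff_uniformCycles :
    (∀ c ∈ σ.partition.parts, c = a) ↔ UniformCycles a σ := by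
  simp only [mem_parts_partition_iff, forall_exists_index, forall_apply_eq_imp_iff]
  rfl

theorem uniformCycles_iff_cycleType {k : ℕ} (ha : 2 ≤ a) (hk : Fintype.card α = a * k) :
    UniformCycles a σ ↔ σ.cycleType = Multiset.replicate k a := by
  rw [← forall_parts_partition_iff_uniformCycles]
  constructor
  · intro h
    have h1 := Multiset.eq_replicate_card.2 h
    have h2 := σ.partition.parts_sum.symm.trans
      ((congrArg Multiset.sum h1).trans (Multiset.sum_replicate _ _))
    have h3 : σ.partition.parts.card = k := by
      refine Nat.eq_of_mul_eq_mul_right (zero_lt_two.trans_le ha) ?_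
      exact h2.symm.trans (hk.trans (mul_comm a k))
    rw [h3] at h1
    rw [← Perm.filter_parts_partition_eq_cycleType, h1, Multiset.filter_eq_self]
    intro b hb
    rwa [Multiset.eq_of_mem_replicate hb]
  · intro h c hc
    have h1 := σ.sum_cycleType
    rw [h, Multiset.sum_replicate, smul_eq_mul, mul_comm, ← hk] at h1
    rw [Perm.parts_partition, h, ← h1, Nat.sub_self, Multiset.replicate_zero, add_zero] at hc
    exact Multiset.eq_of_mem_replicate hc

theorem card_uniformCycles_mul {k : ℕ} (ha : 1 ≤ a) (hk : Fintype.card α = a * k) :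
    Nat.card {σ : Perm α // UniformCycles a σ} * (k.factorial * a ^ k) = (a * k).factorial := by
  rcases ha.eq_or_lt with rfl | ha
  · rw [Nat.card_congr (Equiv.subtypeEquivRight fun σ => uniformCycles_one_iff)]
    simp
  · rw [Nat.card_congr (Equiv.subtypeEquivRight fun σ => uniformCycles_iff_cycleType ha hk),
      Nat.card_eq_fintype_card, Fintype.card_subtype]
    have h := Perm.card_of_cycleType_mul_eq α (Multiset.replicate k a)
    have hsum : (Multiset.replicate k a).sum = a * k := by
      rw [Multiset.sum_replicate, smul_eq_mul, mul_comm]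
    rw [if_pos ⟨by rw [hsum, hk], fun b hb => by rwa [Multiset.eq_of_mem_replicate hb]⟩, hsum, hk,
      Nat.sub_self, Nat.factorial_zero, one_mul, Multiset.prod_replicate] at h
    rw [← h, mul_comm k.factorial]
    rcases Nat.eq_zero_or_pos k with rfl | hk0
    · simp
    · rw [Multiset.toFinset_replicate, if_neg hk0.ne', Finset.prod_singleton,
        Multiset.count_replicate_self]

end Fintype

/-! ### Decomposition into connected components -/

/-- A permutation `σ` with uniform cycles of length `a` together with a monotone sequence of `m`
transpositions. The latter is encoded by a family of words: `w s` lists the smaller elements `r` of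
the transpositions `(r s)`, in their order, so that interleaving the sequences on disjoint subsets
is pasting of functions. -/
def monotoneData (a m : ℕ) (α : Type*) [Fintype α] [LinearOrder α] :
    Set (Perm α × (α → List α)) :=
  {q | UniformCycles a q.1 ∧ (∀ s, ∀ r ∈ q.2 s, r < s) ∧ ∑ s, (q.2 s).length = m}

/-- `T` is a union of orbits of the group generated by the permutation and the transpositions. -/
def IsStable {α : Type*} (q : Perm α × (α → List α)) (T : Set α) : Prop :=
  (∀ x, q.1 x ∈ T ↔ x ∈ T) ∧ ∀ s, ∀ r ∈ q.2 s, (r ∈ T ↔ s ∈ T)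

/-- The permutation and the transpositions generate a transitive group. -/
def IsTransitive {α : Type*} (q : Perm α × (α → List α)) : Prop :=
  ∀ T, IsStable q T → T.Nonempty → T = Set.univ

/-- The members of `monotoneData` that generate a transitive group. -/
def connectedData (a m : ℕ) (α : Type*) [Fintype α] [LinearOrder α] :
    Set (Perm α × (α → List α)) :=
  {q | IsTransitive q ∧ q ∈ monotoneData a m α}

/-- The orbit of `p` under the group generated by the permutation and the transpositions. -/
def component {α : Type*} (q : Perm α × (α → List α)) (p : α) : Set α :=
  ⋂₀ {T | IsStable q T ∧ p ∈ T}

section component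

variable {α : Type*} {q : Perm α × (α → List α)} {T : Set α} {p : α}

theorem IsStable.compl (h : IsStable q T) : IsStable q Tᶜ :=
  ⟨fun x => not_congr (h.1 x), fun s r hr => not_congr (h.2 s r hr)⟩

theorem mem_component : p ∈ component q p := fun _ hT => hT.2

theorem component_subset (h : IsStable q T) (hp : p ∈ T) : component q p ⊆ T :=
  Set.sInter_subset_of_mem ⟨h, hp⟩

theorem isStable_component : IsStable q (component q p) :=
  ⟨fun x => forall₂_congr fun _ hT => hT.1.1 x,
    fun s r hr => forall₂_congr fun _ hT => hT.1.2 s r hr⟩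

theorem isTransitive_iff_forall_mem (p : α) :
    IsTransitive q ↔ ∀ T, IsStable q T → p ∈ T → T = Set.univ := by
  refine ⟨fun h T hT hp => h T hT ⟨p, hp⟩, fun h T hT ⟨x, hx⟩ => ?_⟩
  by_cases hp : p ∈ T
  · exact h T hT hp
  · have := h Tᶜ hT.compl hp
    exact absurd hx (this ▸ Set.mem_univ x : x ∈ Tᶜ)

end component

section merge

theorem forall_iff_pos_and_neg {α : Type*} (P : α → Prop) {Q : α → Prop} :
    (∀ x, Q x) ↔ (∀ x : {x // P x}, Q x) ∧ ∀ x : {x // ¬ P x}, Q x :=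
  ⟨fun h => ⟨fun x => h x, fun x => h x⟩, fun h x =>
    (em (P x)).elim (fun hx => h.1 ⟨x, hx⟩) fun hx => h.2 ⟨x, hx⟩⟩

variable {α : Type*} {P : α → Prop} [DecidablePred P]

/-- Pasting of a permutation and a family of words on `P` with such a pair on its complement. -/
def merge (u : Perm {x // P x} × ({x // P x} → List {x // P x}))
    (v : Perm {x // ¬ P x} × ({x // ¬ P x} → List {x // ¬ P x})) : Perm α × (α → List α) :=
  (u.1.subtypeCongr v.1,
    fun s => if h : P s then (u.2 ⟨s, h⟩).map Subtype.val else (v.2 ⟨s, h⟩).map Subtype.val)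

variable {u u' : Perm {x // P x} × ({x // P x} → List {x // P x})}
  {v v' : Perm {x // ¬ P x} × ({x // ¬ P x} → List {x // ¬ P x})}

theorem merge_fst_pos (x : {x // P x}) : (merge u v).1 x = u.1 x :=
  Perm.subtypeCongr.left_apply_subtype _ _ x

theorem merge_fst_neg (x : {x // ¬ P x}) : (merge u v).1 x = v.1 x :=
  Perm.subtypeCongr.right_apply_subtype _ _ x

theorem merge_snd_pos (s : {x // P x}) : (merge u v).2 s = (u.2 s).map Subtype.val :=
  dif_pos s.2

theorem merge_snd_neg (s : {x // ¬ P x}) : (merge u v).2 s = (v.2 s).map Subtype.val :=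
  dif_neg s.2

theorem merge_injective (h : merge u v = merge u' v') : u = u' ∧ v = v' := by
  refine ⟨Prod.ext (Perm.ext fun x => Subtype.ext ?_) (funext fun s => ?_),
    Prod.ext (Perm.ext fun x => Subtype.ext ?_) (funext fun s => ?_)⟩
  · rw [← merge_fst_pos (v := v), h, merge_fst_pos]
  · refine List.map_injective_iff.2 Subtype.val_injective ?_
    rw [← merge_snd_pos (v := v), h, merge_snd_pos]
  · rw [← merge_fst_neg (u := u), h, merge_fst_neg]
  · refine List.map_injective_iff.2 Subtype.val_injective ?_
    rw [← merge_snd_neg (u := u), h, merge_snd_neg]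

theorem isStable_merge : IsStable (merge u v) {x | P x} := by
  refine ⟨(forall_iff_pos_and_neg P).2 ⟨fun x => ?_, fun x => ?_⟩,
    (forall_iff_pos_and_neg P).2 ⟨fun s r hr => ?_, fun s r hr => ?_⟩⟩
  · rw [merge_fst_pos]
    exact iff_of_true (u.1 x).2 x.2
  · rw [merge_fst_neg]
    exact iff_of_false (v.1 x).2 x.2
  · rw [merge_snd_pos] at hr
    obtain ⟨r, -, rfl⟩ := List.mem_map.1 hr
    exact iff_of_true r.2 s.2
  · rw [merge_snd_neg] at hr
    obtain ⟨r, -, rfl⟩ := List.mem_map.1 hr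
    exact iff_of_false r.2 s.2

theorem exists_merge_eq {q : Perm α × (α → List α)} (h : IsStable q {x | P x}) :
    ∃ u v, merge (P := P) u v = q := by
  have hpos : ∀ s : {x // P x}, ∃ l : List {x // P x}, l.map Subtype.val = q.2 s := by
    intro s
    have hl : ∀ r ∈ q.2 s, P r := fun r hr => (h.2 s r hr).2 s.2
    exact CanLift.prf (q.2 s) hl
  have hneg : ∀ s : {x // ¬ P x}, ∃ l : List {x // ¬ P x}, l.map Subtype.val = q.2 s := by
    intro s
    have hl : ∀ r ∈ q.2 s, ¬ P r := fun r hr => mt (h.2 s r hr).1 s.2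
    exact CanLift.prf (q.2 s) hl
  choose wp hwp using hpos
  choose wn hwn using hneg
  refine ⟨(q.1.subtypePerm h.1, wp), (q.1.subtypePerm fun x => not_congr (h.1 x), wn),
    Prod.ext (Perm.ext ((forall_iff_pos_and_neg P).2 ⟨fun x => ?_, fun x => ?_⟩))
      (funext ((forall_iff_pos_and_neg P).2 ⟨fun s => ?_, fun s => ?_⟩))⟩
  · rw [merge_fst_pos]; rfl
  · rw [merge_fst_neg]; rfl
  · rw [merge_snd_pos, hwp]
  · rw [merge_snd_neg, hwn]

theorem component_merge_eq_iff {p : α} (hp : P p) :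
    component (merge u v) p = {x | P x} ↔ IsTransitive u := by
  constructor
  · intro h
    refine (isTransitive_iff_forall_mem ⟨p, hp⟩).2 fun T hT hpT => Set.eq_univ_of_forall fun x => ?_
    have hst : IsStable (merge u v) (Subtype.val '' T) := by
      have hout : ∀ x : {x // ¬ P x}, (x : α) ∉ Subtype.val '' T := by
        rintro x ⟨y, -, hy⟩
        exact x.2 (hy ▸ y.2)
      have hin : ∀ x : {x // P x}, (x : α) ∈ Subtype.val '' T ↔ x ∈ T := fun x =>
        Subtype.val_injective.mem_set_image
      refine ⟨(forall_iff_pos_and_neg P).2 ⟨fun x => ?_, fun x => ?_⟩,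
        (forall_iff_pos_and_neg P).2 ⟨fun s r hr => ?_, fun s r hr => ?_⟩⟩
      · rw [merge_fst_pos, hin, hin, hT.1]
      · rw [merge_fst_neg]
        exact iff_of_false (hout _) (hout _)
      · rw [merge_snd_pos] at hr
        obtain ⟨r, hr', rfl⟩ := List.mem_map.1 hr
        rw [hin, hin, hT.2 s r hr']
      · rw [merge_snd_neg] at hr
        obtain ⟨r, -, rfl⟩ := List.mem_map.1 hr
        exact iff_of_false (hout _) (hout _)
    have hx : (x : α) ∈ component (merge u v) p := h ▸ x.2
    exact Subtype.val_injective.mem_set_image.1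
      (component_subset hst (Set.mem_image_of_mem _ hpT) hx)
  · intro h
    refine (component_subset isStable_merge hp).antisymm fun x hx => ?_
    have hst : IsStable u (Subtype.val ⁻¹' component (merge u v) p) := by
      have hc := isStable_component (q := merge u v) (p := p)
      refine ⟨fun x => ?_, fun s r hr => hc.2 s r ?_⟩
      · rw [Set.mem_preimage, Set.mem_preimage, ← hc.1 x, merge_fst_pos]
      · rw [merge_snd_pos]
        exact List.mem_map_of_mem hr
    have := h _ hst ⟨⟨p, hp⟩, mem_component⟩
    exact (this ▸ Set.mem_univ (⟨x, hx⟩ : {x // P x}) :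
      _ ∈ Subtype.val ⁻¹' component (merge u v) p)

theorem uniformCycles_merge_iff {a : ℕ} :
    UniformCycles a (merge u v).1 ↔ UniformCycles a u.1 ∧ UniformCycles a v.1 := by
  have hst := isStable_merge (u := u) (v := v)
  have hu : (merge u v).1.subtypePerm hst.1 = u.1 := by
    ext x
    exact merge_fst_pos x
  have hv : (merge u v).1.subtypePerm (fun x => not_congr (hst.1 x)) = v.1 := by
    ext x
    exact merge_fst_neg x
  have hz : ∀ (i : ℤ) x, P (((merge u v).1 ^ i) x) ↔ P x := fun i x => by
    have : ∀ x y, (merge u v).1.SameCycle x y → (P x → P y) := fun x y hxy =>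
      sameCycle_setoid_le_iff (T := Setoid.ker P).2 (fun x => (propext (hst.1 x)).symm) hxy ▸ id
    exact ⟨this _ _ (Perm.SameCycle.symm ⟨i, rfl⟩), this _ _ ⟨i, rfl⟩⟩
  rw [UniformCycles, forall_iff_pos_and_neg P]
  refine and_congr (forall_congr' fun x => ?_) (forall_congr' fun x => ?_)
  · rw [← hu]
    refine Eq.congr_left (Nat.card_congr (Equiv.symm ?_))
    refine (Equiv.subtypeEquivRight fun y => Perm.sameCycle_subtypePerm).trans
      ((Equiv.subtypeSubtypeEquivSubtypeInter P fun y => (merge u v).1.SameCycle x y).trans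
        (Equiv.subtypeEquivRight fun y => and_iff_right_of_imp ?_))
    rintro ⟨i, rfl⟩
    exact (hz i x).2 x.2
  · rw [← hv]
    refine Eq.congr_left (Nat.card_congr (Equiv.symm ?_))
    refine (Equiv.subtypeEquivRight fun y => Perm.sameCycle_subtypePerm).trans
      ((Equiv.subtypeSubtypeEquivSubtypeInter (fun y => ¬ P y)
        fun y => (merge u v).1.SameCycle x y).trans
        (Equiv.subtypeEquivRight fun y => and_iff_right_of_imp ?_))
    rintro ⟨i, rfl⟩
    exact mt (hz i x).1 x.2

theorem merge_mem_monotoneData_iff [Fintype α] [LinearOrder α] {a m : ℕ} :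
    merge u v ∈ monotoneData a m α ↔
      (UniformCycles a u.1 ∧ ∀ s, ∀ r ∈ u.2 s, r < s) ∧
      (UniformCycles a v.1 ∧ ∀ s, ∀ r ∈ v.2 s, r < s) ∧
      (∑ s, (u.2 s).length) + ∑ s, (v.2 s).length = m := by
  have hlt : (∀ s, ∀ r ∈ (merge u v).2 s, r < s) ↔
      (∀ s, ∀ r ∈ u.2 s, r < s) ∧ ∀ s, ∀ r ∈ v.2 s, r < s := by
    rw [forall_iff_pos_and_neg P]
    refine and_congr (forall_congr' fun s => ?_) (forall_congr' fun s => ?_)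
    · rw [merge_snd_pos, List.forall_mem_map]; rfl
    · rw [merge_snd_neg, List.forall_mem_map]; rfl
  have hlen : ∑ s, ((merge u v).2 s).length =
      (∑ s, (u.2 s).length) + ∑ s, (v.2 s).length := by
    rw [← Fintype.sum_subtype_add_sum_subtype P]
    refine congrArg₂ (· + ·) (Finset.sum_congr rfl fun s _ => ?_)
      (Finset.sum_congr rfl fun s _ => ?_)
    · rw [merge_snd_pos, List.length_map]
    · rw [merge_snd_neg, List.length_map]
  change UniformCycles a (merge u v).1 ∧ (∀ s, ∀ r ∈ (merge u v).2 s, r < s) ∧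
    ∑ s, ((merge u v).2 s).length = m ↔ _
  rw [uniformCycles_merge_iff, hlt, hlen]
  tauto

end merge

section card

/-- Transport of a permutation and a family of words along a bijection. -/
def relabel {α β : Type*} (e : α ≃ β) : Perm α × (α → List α) ≃ Perm β × (β → List β) :=
  Equiv.prodCongr e.permCongr (e.arrowCongr (Equiv.listEquivOfEquiv e))

theorem relabel_isTransitive_iff {α β : Type*} (e : α ≃ β) {q : Perm α × (α → List α)} :
    IsTransitive (relabel e q) ↔ IsTransitive q := by
  have hst : ∀ T : Set β, IsStable (relabel e q) T ↔ IsStable q (e ⁻¹' T) := by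
    intro T
    refine and_congr (b := _) ?_ ?_
    · rw [e.surjective.forall]
      refine forall_congr' fun (x : α) => ?_
      change (e (q.1 (e.symm (e x))) ∈ T ↔ e x ∈ T) ↔ _
      rw [e.symm_apply_apply]
      rfl
    · rw [e.surjective.forall]
      refine forall_congr' fun s => ?_
      change (∀ r ∈ (q.2 (e.symm (e s))).map e, _) ↔ _
      rw [e.symm_apply_apply, List.forall_mem_map]
      rfl
  have hsurj : Function.Surjective (Set.preimage e) := e.injective.preimage_surjective
  rw [IsTransitive, IsTransitive, hsurj.forall]
  refine forall_congr' fun T => ?_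
  rw [hst, Set.preimage_eq_univ_iff, e.surjective.range_eq, Set.univ_subset_iff,
    (Set.nonempty_preimage_iff).trans (by rw [e.surjective.range_eq, Set.inter_univ])]

variable {α β : Type*} [Fintype α] [LinearOrder α] [Fintype β] [LinearOrder β] {a m : ℕ}

instance finite_monotoneData : Finite (monotoneData a m α) := by
  have hfin : (Set.univ.pi fun _ : α => {l : List α | l.length ≤ m}).Finite :=
    Set.Finite.pi fun _ => List.finite_length_le α m
  refine ((Set.finite_univ (α := Perm α)).prod hfin).subset ?_ |>.to_subtype
  rintro q ⟨-, -, rfl⟩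
  exact ⟨Set.mem_univ _, fun s _ => Finset.single_le_sum (f := fun s => (q.2 s).length)
    (fun _ _ => Nat.zero_le _) (Finset.mem_univ s)⟩

instance finite_connectedData : Finite (connectedData a m α) :=
  Set.Finite.subset (finite_monotoneData (a := a) (m := m) (α := α)) fun _ hq => hq.2

theorem relabel_mem_monotoneData_iff (e : α ≃o β) {q : Perm α × (α → List α)} :
    relabel e.toEquiv q ∈ monotoneData a m β ↔ q ∈ monotoneData a m α := by
  refine and_congr (uniformCycles_conj _) (and_congr ?_ (Eq.congr_left ?_))
  · rw [e.surjective.forall]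
    refine forall_congr' fun s => ?_
    change (∀ r ∈ (q.2 (e.symm (e s))).map e, r < e s) ↔ _
    rw [e.symm_apply_apply, List.forall_mem_map]
    simp
  · rw [← e.toEquiv.sum_comp]
    refine Finset.sum_congr rfl fun s _ => ?_
    change ((q.2 (e.symm (e s))).map e).length = _
    rw [e.symm_apply_apply, List.length_map]

theorem card_monotoneData_congr (e : α ≃o β) :
    Nat.card (monotoneData a m α) = Nat.card (monotoneData a m β) :=
  Nat.card_congr ((relabel e.toEquiv).subtypeEquiv fun _ =>
    (relabel_mem_monotoneData_iff e).symm)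

theorem card_connectedData_congr (e : α ≃o β) :
    Nat.card (connectedData a m α) = Nat.card (connectedData a m β) :=
  Nat.card_congr ((relabel e.toEquiv).subtypeEquiv fun _ =>
    (and_congr (relabel_isTransitive_iff e.toEquiv) (relabel_mem_monotoneData_iff e)).symm)

/-- The members of `monotoneData` with prescribed orbit of `p` are the pairs of a connected datum on
that orbit and any datum on the complement. -/
theorem card_monotoneData_component (P : α → Prop) [DecidablePred P] {p : α} (hp : P p) :
    Nat.card {q : monotoneData a m α // component q.1 p = {x | P x}} =
      ∑ n ∈ antidiagonal m, Nat.card (connectedData a n.1 {x // P x}) *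
        Nat.card (monotoneData a n.2 {x // ¬ P x}) := by
  let f : (Σ n : antidiagonal m, connectedData a n.1.1 {x // P x} ×
      monotoneData a n.1.2 {x // ¬ P x}) →
      {q : monotoneData a m α // component q.1 p = {x | P x}} := fun t =>
    ⟨⟨merge t.2.1.1 t.2.2.1, merge_mem_monotoneData_iff.2
      ⟨⟨t.2.1.2.2.1, t.2.1.2.2.2.1⟩, ⟨t.2.2.2.1, t.2.2.2.2.1⟩, by
        rw [t.2.1.2.2.2.2, t.2.2.2.2.2]
        exact mem_antidiagonal.1 t.1.2⟩⟩,
      (component_merge_eq_iff hp).2 t.2.1.2.1⟩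
  have hf : Function.Bijective f := by
    constructor
    · rintro ⟨⟨⟨n₁, n₂⟩, hn⟩, ⟨u, hu⟩, ⟨v, hv⟩⟩ ⟨⟨⟨n₁', n₂'⟩, hn'⟩, ⟨u', hu'⟩, ⟨v', hv'⟩⟩ h
      obtain ⟨rfl, rfl⟩ := merge_injective (congrArg (fun t => t.1.1) h)
      obtain rfl : n₁ = n₁' := hu.2.2.2.symm.trans hu'.2.2.2
      obtain rfl : n₂ = n₂' := hv.2.2.symm.trans hv'.2.2
      rfl
    · rintro ⟨⟨q, hq⟩, hc⟩
      obtain ⟨u, v, rfl⟩ := exists_merge_eq (hc ▸ isStable_component)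
      obtain ⟨hu, hv, hlen⟩ := merge_mem_monotoneData_iff.1 hq
      exact ⟨⟨⟨(_, _), mem_antidiagonal.2 hlen⟩,
        ⟨u, (component_merge_eq_iff hp).1 hc, hu.1, hu.2, rfl⟩, ⟨v, hv.1, hv.2, rfl⟩⟩, rfl⟩
  rw [← Nat.card_congr (Equiv.ofBijective f hf), Nat.card_sigma]
  exact (Finset.sum_congr rfl fun n _ => Nat.card_prod _ _).trans
    (Finset.sum_coe_sort (antidiagonal m) fun n =>
      Nat.card (connectedData a n.1 {x // P x}) * Nat.card (monotoneData a n.2 {x // ¬ P x}))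

end card

/-- The exponential formula, in recursive form: split off the orbit of one element. -/
theorem card_monotoneData_succ (a m d : ℕ) :
    Nat.card (monotoneData a m (Fin (d + 1))) =
      ∑ i ∈ Finset.range (d + 1), d.choose i * ∑ n ∈ antidiagonal m,
        Nat.card (connectedData a n.1 (Fin (i + 1))) *
          Nat.card (monotoneData a n.2 (Fin (d - i))) := by
  classical
  set p : Fin (d + 1) := 0
  set f : ℕ → ℕ := fun i => ∑ n ∈ antidiagonal m,
    Nat.card (connectedData a n.1 (Fin (i + 1))) * Nat.card (monotoneData a n.2 (Fin (d - i)))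
    with hf
  have key : ∀ S : Finset (Fin (d + 1)),
      Nat.card {q : monotoneData a m (Fin (d + 1)) // (component q.1 p).toFinset = S} =
        if p ∈ S then f (S.erase p).card else 0 := by
    intro S
    have hS : ∀ q : monotoneData a m (Fin (d + 1)),
        (component q.1 p).toFinset = S ↔ component q.1 p = {x | x ∈ S} := fun q => by
      rw [← Finset.coe_inj, Set.coe_toFinset]; rfl
    rw [Nat.card_congr (Equiv.subtypeEquivRight hS)]
    split_ifs with hp
    · obtain ⟨P, hP⟩ : ∃ P : Fin (d + 1) → Prop, ∀ x, x ∈ S ↔ P x := ⟨_, fun _ => Iff.rfl⟩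
      simp only [hP]
      rw [card_monotoneData_component P ((hP p).1 hp), hf]
      refine Finset.sum_congr rfl fun n _ => ?_
      have hcard := Finset.card_erase_add_one hp
      have e1 : Fin ((S.erase p).card + 1) ≃o {x // P x} :=
        Fintype.orderIsoFinOfCardEq _ (by rw [Fintype.card_of_subtype S hP, hcard])
      have e2 : Fin (d - (S.erase p).card) ≃o {x // ¬ P x} :=
        Fintype.orderIsoFinOfCardEq _ (by
          rw [Fintype.card_subtype_compl, Fintype.card_of_subtype S hP, Fintype.card_fin]
          omega)
      rw [card_connectedData_congr e1, card_monotoneData_congr e2]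
    · have : IsEmpty {q : monotoneData a m (Fin (d + 1)) // component q.1 p = {x | x ∈ S}} :=
        ⟨fun q => hp (q.2 ▸ mem_component : p ∈ {x | x ∈ S})⟩
      exact Nat.card_of_isEmpty
  rw [← Nat.card_congr (Equiv.sigmaFiberEquiv fun q : monotoneData a m (Fin (d + 1)) =>
    (component q.1 p).toFinset), Nat.card_sigma,
    Finset.sum_congr rfl fun (S : Finset (Fin (d + 1))) _ => key S,
    ← Finset.sum_filter]
  have hbij : ∑ S : Finset (Fin (d + 1)) with p ∈ S, f (S.erase p).card =
      ∑ T ∈ (Finset.univ.erase p).powerset, f T.card := by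
    refine Finset.sum_bij' (fun S _ => S.erase p) (fun T _ => insert p T) ?_ ?_ ?_ ?_ ?_
    · intro S _
      exact Finset.mem_powerset.2 (Finset.erase_subset_erase _ (Finset.subset_univ S))
    · intro T _
      simp
    · intro S hS
      exact Finset.insert_erase (Finset.mem_filter.1 hS).2
    · intro T hT
      exact Finset.erase_insert fun h => Finset.notMem_erase p _ (Finset.mem_powerset.1 hT h)
    · intro S _
      rfl
  rw [hbij, Finset.sum_powerset_apply_card, Finset.card_erase_of_mem (Finset.mem_univ p),
    Finset.card_univ, Fintype.card_fin, Nat.add_sub_cancel]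
  simp only [smul_eq_mul, hf]

/-! ### Counting all monotone sequences -/

theorem card_list_of_length {α : Type*} [Fintype α] (P : α → Prop) [DecidablePred P] (n : ℕ) :
    Nat.card {l : List α // (∀ r ∈ l, P r) ∧ l.length = n} = Fintype.card {x // P x} ^ n := by
  rw [← card_vector, ← Nat.card_eq_fintype_card]
  refine (Nat.card_congr (Equiv.ofBijective
    (fun v : List.Vector {x // P x} n => (⟨v.1.map Subtype.val, ?_, ?_⟩ :
      {l : List α // (∀ r ∈ l, P r) ∧ l.length = n})) ⟨?_, ?_⟩)).symm
  · rintro r hr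
    obtain ⟨r, -, rfl⟩ := List.mem_map.1 hr
    exact r.2
  · rw [List.length_map, v.2]
  · intro v v' h
    exact Subtype.ext (List.map_injective_iff.2 Subtype.val_injective (congrArg Subtype.val h))
  · rintro ⟨l, hl, rfl⟩
    lift l to List {x // P x} using hl
    exact ⟨⟨l, by simp⟩, rfl⟩

/-- The choices of the smaller elements of the transpositions `(r s)` with fixed `s` are counted by
`1 / (1 - s X)`, for `s` elements of `Fin d` are smaller than `s`. -/
theorem card_wordFamilies (d m : ℕ) :
    (Nat.card {w : Fin d → List (Fin d) // (∀ s, ∀ r ∈ w s, r < s) ∧ ∑ s, (w s).length = m} : ℚ) =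
      PowerSeries.coeff m (∏ s : Fin d, PowerSeries.mk fun l => ((s : ℕ) : ℚ) ^ l) := by
  classical
  let f : (Σ ℓ : Finset.univ.finsuppAntidiag m, ∀ s : Fin d,
      {l : List (Fin d) // (∀ r ∈ l, r < s) ∧ l.length = ℓ.1 s}) →
      {w : Fin d → List (Fin d) // (∀ s, ∀ r ∈ w s, r < s) ∧ ∑ s, (w s).length = m} := fun t =>
    ⟨fun s => (t.2 s).1, fun s => (t.2 s).2.1, by
      rw [Finset.sum_congr rfl fun s _ => (t.2 s).2.2]
      exact (Finset.mem_finsuppAntidiag.1 t.1.2).1⟩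
  have hf : Function.Bijective f := by
    constructor
    · rintro ⟨⟨ℓ, hℓ⟩, u⟩ ⟨⟨ℓ', hℓ'⟩, u'⟩ h
      have h' : ∀ s, (u s).1 = (u' s).1 := fun s => congrFun (congrArg Subtype.val h) s
      obtain rfl : ℓ = ℓ' := Finsupp.ext fun s =>
        (u s).2.2.symm.trans ((congrArg List.length (h' s)).trans (u' s).2.2)
      obtain rfl : u = u' := funext fun s => Subtype.ext (h' s)
      rfl
    · rintro ⟨w, hw, hm⟩
      exact ⟨⟨⟨Finsupp.equivFunOnFinite.symm fun s => (w s).length,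
        Finset.mem_finsuppAntidiag.2 ⟨hm, Finset.subset_univ _⟩⟩, fun s => ⟨w s, hw s, rfl⟩⟩,
        Subtype.ext (funext fun s => rfl)⟩
  have hfin : ∀ (ℓ : Fin d →₀ ℕ) (s : Fin d),
      Finite {l : List (Fin d) // (∀ r ∈ l, r < s) ∧ l.length = ℓ s} := fun ℓ s =>
    (List.finite_length_le (Fin d) (ℓ s)).subset fun l hl => hl.2.le
  have hcard : ∀ (ℓ : Fin d →₀ ℕ) (s : Fin d),
      (Nat.card {l : List (Fin d) // (∀ r ∈ l, r < s) ∧ l.length = ℓ s} : ℚ) =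
        PowerSeries.coeff (ℓ s) (PowerSeries.mk fun l => ((s : ℕ) : ℚ) ^ l) := by
    intro ℓ s
    have hlt : Fintype.card {r : Fin d // r < s} = s := by
      rw [Fintype.card_subtype, Finset.filter_gt_eq_Iio, Fin.card_Iio]
    rw [card_list_of_length (fun r => r < s), PowerSeries.coeff_mk, hlt, Nat.cast_pow]
  rw [← Nat.card_congr (Equiv.ofBijective f hf), Nat.card_sigma, PowerSeries.coeff_prod,
    Nat.cast_sum]
  refine Eq.trans (Finset.sum_congr rfl fun ℓ _ => ?_) (Finset.sum_coe_sort _ _)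
  rw [Nat.card_pi, Nat.cast_prod]
  exact Finset.prod_congr rfl fun s _ => hcard ℓ.1 s

theorem card_monotoneData_fin (a m d : ℕ) :
    (Nat.card (monotoneData a m (Fin d)) : ℚ) =
      Nat.card {σ : Perm (Fin d) // UniformCycles a σ} *
        PowerSeries.coeff m (∏ s : Fin d, PowerSeries.mk fun l => ((s : ℕ) : ℚ) ^ l) := by
  rw [← card_wordFamilies, ← Nat.cast_mul, ← Nat.card_prod]
  exact congrArg _ (Nat.card_congr (Equiv.subtypeProdEquivProd
    (p := UniformCycles a) (q := fun w : Fin d → List (Fin d) =>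
      (∀ s, ∀ r ∈ w s, r < s) ∧ ∑ s, (w s).length = m)))

/-! ### Monotone sequences of transpositions as families of words -/

/-- A list that is sorted by second entries is determined by its sublists with constant second
entry. -/
theorem eq_of_forall_filter_eq {α β : Type*} [LinearOrder β] {l₁ l₂ : List (α × β)}
    (h₁ : l₁.Pairwise fun p q => p.2 ≤ q.2) (h₂ : l₂.Pairwise fun p q => p.2 ≤ q.2)
    (h : ∀ s, l₁.filter (fun p => p.2 = s) = l₂.filter fun p => p.2 = s) : l₁ = l₂ := by
  have hmem : ∀ p, p ∈ l₁ ↔ p ∈ l₂ := fun p => by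
    have := congrArg (p ∈ ·) (h p.2)
    simpa using this
  induction l₁ generalizing l₂ with
  | nil => exact (List.eq_nil_iff_forall_not_mem.2 fun p hp => List.not_mem_nil ((hmem p).2 hp)).symm
  | cons p l₁ ih =>
    cases l₂ with
    | nil => exact absurd ((hmem p).1 List.mem_cons_self) List.not_mem_nil
    | cons q l₂ =>
      have hpq : p.2 = q.2 := by
        refine le_antisymm ?_ ?_
        · rcases List.mem_cons.1 ((hmem q).2 List.mem_cons_self) with rfl | hq
          · exact le_rfl
          · exact List.rel_of_pairwise_cons h₁ hq
        · rcases List.mem_cons.1 ((hmem p).1 List.mem_cons_self) with rfl | hp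
          · exact le_rfl
          · exact List.rel_of_pairwise_cons h₂ hp
      have hhead := h p.2
      rw [List.filter_cons_of_pos (by simp), List.filter_cons_of_pos (by simp [hpq])] at hhead
      obtain rfl := (List.cons.inj hhead).1
      have htail : ∀ s, l₁.filter (fun p => p.2 = s) = l₂.filter fun p => p.2 = s := fun s => by
        have := h s
        rw [List.filter_cons, List.filter_cons] at this
        split_ifs at this
        · exact (List.cons.inj this).2
        · exact this
      rw [ih h₁.of_cons h₂.of_cons htail fun p => by
        have := congrArg (p ∈ ·) (htail p.2)
        simpa using this]

/-- The pairs `(r, s)` with `r` in the word of `s`, ordered by `s`. -/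
def wordPairs {d : ℕ} (w : Fin d → List (Fin d)) : List (Fin d × Fin d) :=
  (List.finRange d).flatMap fun s => (w s).map fun r => (r, s)

section wordPairs

variable {d : ℕ} {w w' : Fin d → List (Fin d)}

theorem mem_wordPairs {p : Fin d × Fin d} : p ∈ wordPairs w ↔ p.1 ∈ w p.2 := by
  simp only [wordPairs, List.mem_flatMap, List.mem_finRange, true_and, List.mem_map]
  constructor
  · rintro ⟨s, r, hr, rfl⟩
    exact hr
  · intro h
    exact ⟨p.2, p.1, h, rfl⟩

theorem length_wordPairs : (wordPairs w).length = ∑ s, (w s).length := by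
  simp [wordPairs, List.length_flatMap, ← List.ofFn_eq_map, List.sum_ofFn]

theorem pairwise_wordPairs : (wordPairs w).Pairwise fun p q => p.2 ≤ q.2 := by
  rw [wordPairs, List.pairwise_flatMap]
  refine ⟨fun s _ => ?_, (List.pairwise_le_finRange d).imp fun {s t} hst p hp q hq => ?_⟩
  · rw [List.pairwise_map]
    exact List.pairwise_of_forall fun _ _ => le_rfl
  · obtain ⟨r, -, rfl⟩ := List.mem_map.1 hp
    obtain ⟨r', -, rfl⟩ := List.mem_map.1 hq
    exact hst

theorem filter_wordPairs (s : Fin d) :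
    (wordPairs w).filter (fun p => p.2 = s) = (w s).map fun r => (r, s) := by
  rw [wordPairs, List.filter_flatMap]
  have : (fun t => ((w t).map fun r => (r, t)).filter fun p => p.2 = s) =
      fun t => if t = s then (w s).map fun r => (r, s) else [] := by
    funext t
    split_ifs with h
    · subst h
      rw [List.filter_eq_self]
      simp
    · rw [List.filter_eq_nil_iff]
      simp [h]
  rw [this]
  have key : ∀ l : List (Fin d), l.Nodup → s ∈ l →
      (l.flatMap fun t => if t = s then (w s).map fun r => (r, s) else []) =
        (w s).map fun r => (r, s) := by
    intro l hl hs
    induction l with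
    | nil => simp at hs
    | cons t l ih =>
      rw [List.flatMap_cons]
      by_cases hts : t = s
      · subst hts
        rw [if_pos rfl, List.flatMap_eq_nil_iff.2, List.append_nil]
        intro x hx
        rw [if_neg]
        rintro rfl
        exact (List.nodup_cons.1 hl).1 hx
      · rw [if_neg hts, List.nil_append]
        exact ih (List.nodup_cons.1 hl).2 ((List.mem_cons.1 hs).resolve_left (Ne.symm hts))
  exact key _ (List.nodup_finRange d) (List.mem_finRange s)

theorem wordPairs_injective : Function.Injective (wordPairs (d := d)) := by
  intro w w' h
  funext s
  have := filter_wordPairs (w := w) s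
  rw [h, filter_wordPairs] at this
  exact (List.map_injective_iff.2 (fun r r' hr => (Prod.mk.inj hr).1) this).symm

theorem exists_wordPairs_eq {rs : List (Fin d × Fin d)} (h : rs.Pairwise fun p q => p.2 ≤ q.2) :
    ∃ w, wordPairs w = rs := by
  refine ⟨fun s => (rs.filter fun p => p.2 = s).map Prod.fst,
    eq_of_forall_filter_eq pairwise_wordPairs h fun s => ?_⟩
  rw [filter_wordPairs, List.map_map]
  conv_rhs => rw [← List.map_id (rs.filter fun p => p.2 = s)]
  refine List.map_congr_left fun p hp => ?_
  have : p.2 = s := by simpa using (List.mem_filter.1 hp).2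
  subst this
  rfl

end wordPairs

theorem swap_injOn {d : ℕ} {p q : Fin d × Fin d} (hp : p.1 < p.2) (hq : q.1 < q.2)
    (h : swap p.1 p.2 = swap q.1 q.2) : p = q := by
  have h1 : swap q.1 q.2 p.1 = p.2 := by rw [← h, swap_apply_left]
  obtain ⟨r, s⟩ := p
  obtain ⟨r', s'⟩ := q
  simp only at *
  rw [swap_apply_def] at h1
  split_ifs at h1 with h2 h3
  · rw [h2, h1]
  · subst h3 h1
    exact absurd hp hq.asymm
  · exact absurd h1 hp.ne

theorem map_swap_injOn {d : ℕ} {l l' : List (Fin d × Fin d)} (hl : ∀ p ∈ l, p.1 < p.2)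
    (hl' : ∀ p ∈ l', p.1 < p.2)
    (h : (l.map fun p => swap p.1 p.2) = l'.map fun p => swap p.1 p.2) : l = l' := by
  lift l to List {p : Fin d × Fin d // p.1 < p.2} using hl
  lift l' to List {p : Fin d × Fin d // p.1 < p.2} using hl'
  rw [List.map_map, List.map_map] at h
  rw [List.map_injective_iff.2 (fun p q hpq => Subtype.ext (swap_injOn p.2 q.2 hpq)) h]

theorem isTransitive_iff_isPretransitive {d : ℕ} {q : Perm (Fin d) × (Fin d → List (Fin d))} :
    IsTransitive q ↔ MulAction.IsPretransitive (Subgroup.closure ({q.1} ∪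
      {t | t ∈ (wordPairs q.2).map fun p => swap p.1 p.2})) (Fin d) := by
  set H := Subgroup.closure ({q.1} ∪ {t | t ∈ (wordPairs q.2).map fun p => swap p.1 p.2})
  have hσ : q.1 ∈ H := Subgroup.subset_closure (Or.inl rfl)
  have hswap : ∀ s, ∀ r ∈ q.2 s, swap r s ∈ H := fun s r hr =>
    Subgroup.subset_closure (Or.inr (List.mem_map.2 ⟨(r, s), mem_wordPairs.2 hr, rfl⟩))
  constructor
  · intro h
    refine ⟨fun x y => ?_⟩
    have hinv : ∀ g ∈ H, ∀ y, (∃ g ∈ H, g x = y) → ∃ g' ∈ H, g' x = g y := by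
      rintro g hg y ⟨g', hg', rfl⟩
      exact ⟨g * g', H.mul_mem hg hg', rfl⟩
    have hst : IsStable q {y | ∃ g ∈ H, g x = y} := by
      refine ⟨fun y => ⟨fun hy => ?_, hinv _ hσ y⟩, fun s r hr => ⟨fun hy => ?_, fun hy => ?_⟩⟩
      · have := hinv _ (H.inv_mem hσ) _ hy
        rwa [← Perm.mul_apply, inv_mul_cancel, Perm.one_apply] at this
      · have := hinv _ (hswap s r hr) _ hy
        rwa [swap_apply_left] at this
      · have := hinv _ (hswap s r hr) _ hy
        rwa [swap_apply_right] at this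
    have huniv := h _ hst ⟨x, 1, H.one_mem, rfl⟩
    obtain ⟨g, hg, hgy⟩ : y ∈ {y | ∃ g ∈ H, g x = y} := huniv ▸ Set.mem_univ y
    exact ⟨⟨g, hg⟩, hgy⟩
  · rintro ⟨h⟩ T hT ⟨x, hx⟩
    have hinv : ∀ g ∈ H, ∀ y, g y ∈ T ↔ y ∈ T := by
      intro g hg
      induction hg using Subgroup.closure_induction with
      | mem g hg =>
        rcases hg with rfl | hg
        · exact hT.1
        · obtain ⟨⟨r, s⟩, hp, rfl⟩ := List.mem_map.1 hg
          have hrs := hT.2 s r (mem_wordPairs.1 hp)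
          intro y
          simp only
          rcases eq_or_ne y r with rfl | hr
          · rw [swap_apply_left, hrs]
          rcases eq_or_ne y s with rfl | hs
          · rw [swap_apply_right, hrs]
          · rw [swap_apply_of_ne_of_ne hr hs]
      | one => exact fun y => Iff.rfl
      | mul g g' _ _ ih ih' => exact fun y => (ih _).trans (ih' _)
      | inv g _ ih => exact fun y => by rw [← ih, ← Perm.mul_apply, mul_inv_cancel, Perm.one_apply]
    refine Set.eq_univ_of_forall fun y => ?_
    obtain ⟨⟨g, hg⟩, rfl⟩ := h x y
    exact (hinv g hg x).2 hx

/-- The pairs of a permutation with uniform cycles of length `a` and a monotone sequence of `m`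
transpositions that generate a transitive group. -/
def transitiveFactorisations (a m d : ℕ) : Set (Perm (Fin d) × List (Perm (Fin d))) :=
  {x | x.2.length = m ∧ (∀ c ∈ x.1.partition.parts, c = a) ∧ IsMonotoneTranspositions x.2 ∧
    MulAction.IsPretransitive (Subgroup.closure ({x.1} ∪ {t | t ∈ x.2})) (Fin d)}

/-- Connected data and transitive factorisations correspond to each other. -/
theorem bijOn_connectedData (a m d : ℕ) :
    Set.BijOn (fun q : Perm (Fin d) × (Fin d → List (Fin d)) =>
        (q.1, (wordPairs q.2).map fun p => swap p.1 p.2))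
      (connectedData a m (Fin d)) (transitiveFactorisations a m d) := by
  have hlt : ∀ {w : Fin d → List (Fin d)}, (∀ s, ∀ r ∈ w s, r < s) ↔
      ∀ p ∈ wordPairs w, p.1 < p.2 := fun {w} =>
    ⟨fun h p hp => h _ _ (mem_wordPairs.1 hp), fun h s r hr => h (r, s) (mem_wordPairs.2 hr)⟩
  refine ⟨?_, ?_, ?_⟩
  · rintro q ⟨h1, h2, h3, h4⟩
    refine ⟨by rw [List.length_map, length_wordPairs, h4],
      forall_parts_partition_iff_uniformCycles.2 h2, ⟨_, rfl, hlt.1 h3, pairwise_wordPairs⟩,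
      isTransitive_iff_isPretransitive.1 h1⟩
  · rintro ⟨σ, w⟩ ⟨-, -, h, -⟩ ⟨σ', w'⟩ ⟨-, -, h', -⟩ heq
    obtain ⟨rfl, h2⟩ := Prod.mk.inj heq
    exact Prod.ext rfl (wordPairs_injective (map_swap_injOn (hlt.1 h) (hlt.1 h') h2))
  · rintro ⟨σ, τ⟩ ⟨h1, h2, ⟨rs, rfl, h3, h4⟩, h5⟩
    obtain ⟨w, rfl⟩ := exists_wordPairs_eq h4
    refine ⟨(σ, w), ⟨isTransitive_iff_isPretransitive.2 h5,
      forall_parts_partition_iff_uniformCycles.1 h2, hlt.2 h3, ?_⟩, rfl⟩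
    rw [← h1, List.length_map, length_wordPairs]

theorem card_transitiveFactorisations (a m d : ℕ) :
    Nat.card (transitiveFactorisations a m d) = Nat.card (connectedData a m (Fin d)) :=
  (Nat.card_congr (bijOn_connectedData a m d).equiv).symm

/-- The Riemann–Hurwitz formula for transitive factorisations; `g` is the genus. -/
theorem exists_genus {a m d : ℕ} (hd : 0 < d) {x : Perm (Fin d) × List (Perm (Fin d))}
    (hx : x ∈ transitiveFactorisations a m d) :
    ∃ k g : ℕ, k * a = d ∧
      k + numClasses (Perm.SameCycle.setoid (x.1 * x.2.prod)) + 2 * g = 2 + m := by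
  obtain ⟨⟨σ, w⟩, ⟨ht, hu, hlt, hm⟩, rfl⟩ := (bijOn_connectedData a m d).surjOn hx
  obtain ⟨O, hσ, hO, -, g, hg⟩ := exists_orbits_riemannHurwitz σ (wordPairs w)
    fun p hp => (hlt _ _ (mem_wordPairs.1 hp)).ne
  have hO1 : numClasses O = 1 := by
    have hst : IsStable (σ, w) {y | O ⟨0, hd⟩ y} :=
      ⟨fun y => ⟨fun hy => O.trans hy (O.symm (hσ y)), fun hy => O.trans hy (hσ y)⟩,
        fun s r hr => ⟨fun hy => O.trans hy (hO (r, s) (mem_wordPairs.2 hr)),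
          fun hy => O.trans hy (O.symm (hO (r, s) (mem_wordPairs.2 hr)))⟩⟩
    have huniv := ht _ hst ⟨_, O.refl _⟩
    refine Nat.card_eq_one_iff_unique.2 ⟨⟨fun c c' => ?_⟩, ⟨Quotient.mk O ⟨0, hd⟩⟩⟩
    have h0 : ∀ c : Quotient O, c = Quotient.mk O ⟨0, hd⟩ := fun c =>
      Quotient.inductionOn c fun y => Quotient.sound
        (O.symm (show y ∈ {y | O ⟨0, hd⟩ y} from huniv ▸ Set.mem_univ y))
    rw [h0 c, h0 c']
  refine ⟨_, g, (numClasses_mul_of_uniformCycles hu).trans (Nat.card_fin d), ?_⟩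
  rw [hg, hO1, length_wordPairs, hm]

/-! ### The coefficients of the free energies -/

/-- The transitive factorisations in degree `d` with `m` transpositions, `m - d / a = r`. -/
def eulerFactorisations (a d : ℕ) (r : ℤ) : Set (Perm (Fin d) × List (Perm (Fin d))) :=
  {x | (x.2.length : ℚ) = r + (d : ℚ) / a ∧ x ∈ transitiveFactorisations a x.2.length d}

/-- The number of cycles of the product of a factorisation. -/
noncomputable def numCycles {d : ℕ} (x : Perm (Fin d) × List (Perm (Fin d))) : ℕ :=
  numClasses (Perm.SameCycle.setoid (x.1 * x.2.prod))

instance finite_eulerFactorisations (a d : ℕ) (r : ℤ) : Finite (eulerFactorisations a d r) :=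
  ((Set.finite_univ (α := Perm (Fin d))).prod
    (List.finite_length_le (Perm (Fin d)) ⌊(r + (d : ℚ) / a : ℚ)⌋₊)).subset fun _ hx =>
      ⟨Set.mem_univ _, Nat.le_floor hx.1.le⟩

/-- The labellings of the cycles of the product of a factorisation. -/
abbrev Labelling {d : ℕ} (n : ℕ) (x : Perm (Fin d) × List (Perm (Fin d))) : Type :=
  Quotient (Perm.SameCycle.setoid (x.1 * x.2.prod)) ≃ Fin n

theorem card_labelling {d n : ℕ} (x : Perm (Fin d) × List (Perm (Fin d))) :
    Nat.card (Labelling n x) = if numCycles x = n then n.factorial else 0 := by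
  split_ifs with h
  · have e : Quotient (Perm.SameCycle.setoid (x.1 * x.2.prod)) ≃ Fin n := Finite.equivFinOfCardEq h
    rw [Nat.card_congr (Equiv.equivCongr e (Equiv.refl (Fin n))), Nat.card_perm, Nat.card_fin]
  · have : IsEmpty (Labelling n x) := ⟨fun e => h ((Nat.card_congr e).trans (Nat.card_fin n))⟩
    exact Nat.card_of_isEmpty

/-- The lengths of the labelled cycles. -/
noncomputable def cycleLengths {d n : ℕ} {x : Perm (Fin d) × List (Perm (Fin d))}
    (e : Labelling n x) : Fin n →₀ ℕ :=
  Finsupp.equivFunOnFinite.symm fun i => Nat.card {y : Fin d // e (Quotient.mk _ y) = i}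

theorem sum_cycleLengths {d n : ℕ} {x : Perm (Fin d) × List (Perm (Fin d))}
    (e : Labelling n x) : ∑ i, cycleLengths e i = d := by
  have := Nat.card_congr (Equiv.sigmaFiberEquiv fun y : Fin d =>
    e (Quotient.mk (Perm.SameCycle.setoid (x.1 * x.2.prod)) y))
  rw [Nat.card_sigma, Nat.card_fin] at this
  exact this

theorem one_le_cycleLengths {d n : ℕ} {x : Perm (Fin d) × List (Perm (Fin d))}
    (e : Labelling n x) (i : Fin n) : 1 ≤ cycleLengths e i := by
  obtain ⟨y, hy⟩ := Quotient.exists_rep (e.symm i)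
  have : Nonempty {y : Fin d // e (Quotient.mk _ y) = i} := ⟨y, by
    rw [hy, Equiv.apply_symm_apply]⟩
  exact Nat.card_pos

/-- A factorisation in the sense of `Factorisation`, with the degree `∑ i, μ i` replaced by an equal
number `d`. -/
theorem card_factorisation {a g n d : ℕ} (μ : Fin n →₀ ℕ) (hd : ∑ i, μ i = d) :
    Nat.card (Factorisation a g fun i => μ i) =
      Nat.card {t : Σ x : eulerFactorisations a d (2 * g - 2 + n), Labelling n x.1 //
        cycleLengths t.2 = μ} := by
  subst hd
  have hr : ((2 * (g : ℤ) - 2 + n : ℤ) : ℚ) = 2 * g - 2 + n := by push_cast; rfl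
  exact Nat.card_congr
    { toFun := fun φ => ⟨⟨⟨(φ.σ₀, φ.σ), by rw [hr]; exact φ.length_eq,
          rfl, φ.cycleType_eq, φ.monotone, φ.transitive⟩, φ.label⟩, Finsupp.ext φ.label_card⟩
      invFun := fun t => ⟨t.1.1.1.1, t.1.1.1.2, t.1.2, by
          have := t.1.1.2.1
          rwa [hr] at this, t.1.1.2.2.2.1, t.1.1.2.2.2.2.1,
          fun i => DFunLike.congr_fun t.2 i, t.1.1.2.2.2.2.2⟩
      left_inv := fun _ => rfl
      right_inv := fun _ => rfl }

/-- Summation over the cycle lengths removes them from the data; the labellings contribute `n!`. -/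
theorem sum_card_factorisation (a g n d : ℕ) :
    ∑ μ ∈ (Finset.univ.finsuppAntidiag d).filter (fun μ : Fin n →₀ ℕ => ∀ i, 1 ≤ μ i),
        Nat.card (Factorisation a g fun i => μ i) =
      n.factorial *
        Nat.card {x : eulerFactorisations a d (2 * g - 2 + n) // numCycles x.1 = n} := by
  classical
  set M := (Finset.univ.finsuppAntidiag d).filter (fun μ : Fin n →₀ ℕ => ∀ i, 1 ≤ μ i) with hM
  set B := eulerFactorisations a d (2 * g - 2 + n)
  have hmem : ∀ t : (Σ x : B, Labelling n x.1), cycleLengths t.2 ∈ M := fun t =>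
    Finset.mem_filter.2 ⟨Finset.mem_finsuppAntidiag.2 ⟨sum_cycleLengths t.2, Finset.subset_univ _⟩,
      one_le_cycleLengths t.2⟩
  let f : (Σ x : B, Labelling n x.1) → M := fun t => ⟨cycleLengths t.2, hmem t⟩
  have h1 : ∀ μ : M, Nat.card (Factorisation a g fun i => μ.1 i) =
      Nat.card {t // f t = μ} := fun μ => by
    rw [card_factorisation μ.1 (Finset.mem_finsuppAntidiag.1 (Finset.mem_filter.1 μ.2).1).1]
    exact Nat.card_congr (Equiv.subtypeEquivRight fun t =>
      ⟨fun h => Subtype.ext h, fun h => congrArg Subtype.val h⟩)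
  have := Fintype.ofFinite B
  rw [← Finset.sum_coe_sort, Finset.sum_congr rfl fun μ _ => h1 μ, ← Nat.card_sigma,
    Nat.card_congr (Equiv.sigmaFiberEquiv f), Nat.card_sigma,
    Finset.sum_congr rfl fun x _ => card_labelling x.1, ← Finset.sum_filter, Finset.sum_const,
    smul_eq_mul, mul_comm, Nat.card_eq_fintype_card, Fintype.card_subtype]

theorem coeff_diagFreeEnergy (a g n d : ℕ) :
    PowerSeries.coeff d (diagFreeEnergy a g n) = (n.factorial : ℚ) / d.factorial *
      Nat.card {x : eulerFactorisations a d (2 * g - 2 + n) // numCycles x.1 = n} := by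
  classical
  have hs : MvPowerSeries.HasSubst (fun _ : Fin n => (PowerSeries.X : PowerSeries ℚ)) :=
    MvPowerSeries.hasSubst_of_constantCoeff_zero fun _ => PowerSeries.constantCoeff_X
  have hX : ∀ μ : Fin n →₀ ℕ, MvPowerSeries.coeff (Finsupp.single () d)
      (μ.prod fun _ e => (PowerSeries.X : PowerSeries ℚ) ^ e) =
        if d = ∑ i, μ i then 1 else 0 := fun μ => by
    rw [Finsupp.prod_fintype _ _ fun _ => pow_zero _, Finset.prod_pow_eq_pow_sum]
    exact PowerSeries.coeff_X_pow d _
  set M := (Finset.univ.finsuppAntidiag d).filter (fun μ : Fin n →₀ ℕ => ∀ i, 1 ≤ μ i) with hM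
  have key : PowerSeries.coeff d (diagFreeEnergy a g n) =
      ∑ μ ∈ M, 1 / (d.factorial : ℚ) * (Nat.card (Factorisation a g fun i => μ i) : ℚ) := by
    refine (MvPowerSeries.coeff_subst hs (freeEnergy a g n) (Finsupp.single () d)).trans ?_
    rw [finsum_eq_sum_of_support_subset (s := M)]
    · refine Finset.sum_congr rfl fun μ hμ => ?_
      obtain ⟨h1, h2⟩ := Finset.mem_filter.1 hμ
      have h3 : ∑ i, μ i = d := (Finset.mem_finsuppAntidiag.1 h1).1
      rw [hX, if_pos h3.symm, smul_eq_mul, mul_one]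
      refine (if_pos h2).trans ?_
      rw [hurwitz, h3]
    · intro μ hμ
      rw [Function.mem_support, hX] at hμ
      refine Finset.mem_filter.2 ⟨Finset.mem_finsuppAntidiag.2 ⟨?_, Finset.subset_univ _⟩, ?_⟩
      · by_contra h
        rw [if_neg (Ne.symm h), smul_zero] at hμ
        exact hμ rfl
      · by_contra h
        have : MvPowerSeries.coeff μ (freeEnergy a g n) = 0 := if_neg h
        rw [this, zero_smul] at hμ
        exact hμ rfl
  rw [key, ← Finset.mul_sum, ← Nat.cast_sum, sum_card_factorisation]
  push_cast
  ring

theorem exists_genus_of_mem_eulerFactorisations {a d : ℕ} (hd : 0 < d) {r : ℤ}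
    {x : Perm (Fin d) × List (Perm (Fin d))} (hx : x ∈ eulerFactorisations a d r) :
    ∃ g : ℕ, 2 * (g : ℤ) - 2 + numCycles x = r := by
  obtain ⟨k, g, hk, hg⟩ := exists_genus hd hx.2
  refine ⟨g, ?_⟩
  have ha : (a : ℚ) ≠ 0 := by
    rintro h
    rw [Nat.cast_eq_zero] at h
    subst h
    omega
  have hda : (d : ℚ) / a = k := by rw [← hk, Nat.cast_mul, mul_div_cancel_right₀ _ ha]
  have h1 := hx.1
  rw [hda] at h1
  have h2 : (x.2.length : ℤ) = r + k := by exact_mod_cast h1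
  change k + numCycles x + 2 * g = 2 + x.2.length at hg
  omega

theorem finsum_card_fiber {X ι : Type*} [Finite X] (φ : X → ι) :
    ∑ᶠ p, (Nat.card {x // φ x = p} : ℚ) = Nat.card X := by
  classical
  have := Fintype.ofFinite X
  rw [finsum_eq_sum_of_support_subset (s := Finset.univ.image φ), ← Nat.cast_sum,
    Nat.card_eq_fintype_card, ← Finset.card_univ,
    Finset.card_eq_sum_card_image φ Finset.univ]
  · simp only [Nat.card_eq_fintype_card, Fintype.card_subtype]
  · intro p hp
    rw [Function.mem_support, Nat.cast_ne_zero, Nat.card_ne_zero] at hp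
    obtain ⟨⟨x, hx⟩⟩ := hp.1
    simpa using ⟨x, hx⟩

/-- Every transitive factorisation has exactly one genus and one number of cycles, so that summation
over both removes them from the data. -/
theorem coeff_coeff_exponent {a d : ℕ} (hd : 0 < d) (r : ℤ) :
    (PowerSeries.coeff d (exponent a)).coeff r =
      1 / (d.factorial : ℚ) * Nat.card (eulerFactorisations a d r) := by
  have hpos : ∀ x : eulerFactorisations a d r, 0 < numCycles x.1 := fun x => by
    have : Nonempty (Quotient (Perm.SameCycle.setoid (x.1.1 * x.1.2.prod))) :=
      ⟨Quotient.mk _ ⟨0, hd⟩⟩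
    exact Nat.card_pos
  choose γ hγ using fun x : eulerFactorisations a d r =>
    exists_genus_of_mem_eulerFactorisations hd x.2
  let φ : eulerFactorisations a d r → ℕ × ℕ+ := fun x => (γ x, ⟨numCycles x.1, hpos x⟩)
  have hφ : ∀ x g n, φ x = (g, n) ↔ γ x = g ∧ numCycles x.1 = n := fun x g n =>
    Prod.ext_iff.trans (and_congr_right fun _ => PNat.coe_inj.symm)
  rw [← finsum_card_fiber φ, ← smul_eq_mul, smul_finsum, exponent, PowerSeries.coeff_mk,
    HahnSeries.SummableFamily.coeff_hsum]
  refine finsum_congr fun p => ?_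
  obtain ⟨g, n⟩ := p
  change (HahnSeries.single (2 * (g : ℤ) - 2 + ((n : ℕ) : ℤ))
    (1 / ((n : ℕ).factorial : ℚ) * PowerSeries.coeff d (diagFreeEnergy a g n))).coeff r = _
  by_cases hr : r = 2 * (g : ℤ) - 2 + ((n : ℕ) : ℤ)
  · have hφ' : ∀ x : eulerFactorisations a d r, numCycles x.1 = n ↔ φ x = (g, n) := fun x => by
      have := hγ x
      rw [hφ]
      omega
    rw [← hr, HahnSeries.coeff_single_same, coeff_diagFreeEnergy, ← hr,
      Nat.card_congr (Equiv.subtypeEquivRight hφ'), smul_eq_mul]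
    have := Nat.cast_ne_zero (R := ℚ).2 (Nat.factorial_ne_zero n)
    field_simp
  · rw [HahnSeries.coeff_single_of_ne hr]
    have : IsEmpty {x // φ x = (g, n)} := ⟨fun x => hr (by
      have h1 := hγ x.1
      obtain ⟨h2, h3⟩ := (hφ _ _ _).1 x.2
      rw [← h1, h2, h3])⟩
    rw [Nat.card_of_isEmpty, Nat.cast_zero, smul_zero]

theorem card_eulerFactorisations {a k : ℕ} (ha : 1 ≤ a) (r : ℤ) :
    Nat.card (eulerFactorisations a (a * k) r) =
      if r + k < 0 then 0 else Nat.card (connectedData a (r + k).natAbs (Fin (a * k))) := by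
  have ha' : (a : ℚ) ≠ 0 := by positivity
  have hlen : ∀ m : ℕ, (m : ℚ) = r + ((a * k : ℕ) : ℚ) / a ↔ (m : ℤ) = r + k := fun m => by
    rw [Nat.cast_mul, mul_div_cancel_left₀ _ ha']
    exact_mod_cast Iff.rfl
  split_ifs with h
  · have : IsEmpty (eulerFactorisations a (a * k) r) := ⟨fun x => by
      have := (hlen _).1 x.2.1
      omega⟩
    exact Nat.card_of_isEmpty
  · rw [← card_transitiveFactorisations]
    refine Nat.card_congr (Equiv.subtypeEquivRight fun x => ⟨fun hx => ?_, fun hx => ?_⟩)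
    · have h1 := (hlen _).1 hx.1
      rw [show (r + k).natAbs = x.2.length by omega]
      exact hx.2
    · have h1 : x.2.length = (r + k).natAbs := hx.1
      exact ⟨(hlen _).2 (by omega), h1 ▸ hx⟩

theorem card_connectedData_le {a m d : ℕ} :
    Nat.card (connectedData a m (Fin d)) ≤ Nat.card (monotoneData a m (Fin d)) :=
  Nat.card_le_card_of_injective (fun q => ⟨q.1, q.2.2⟩) fun _ _ h =>
    Subtype.ext (congrArg (fun t => t.1) h)

theorem card_monotoneData_of_not_dvd {a m d : ℕ} (h : ¬ a ∣ d) :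
    Nat.card (monotoneData a m (Fin d)) = 0 := by
  have : IsEmpty (monotoneData a m (Fin d)) := ⟨fun q => h
    ⟨_, by rw [mul_comm, numClasses_mul_of_uniformCycles q.2.1, Nat.card_fin]⟩⟩
  exact Nat.card_of_isEmpty

theorem card_eulerFactorisations_of_not_dvd {a d : ℕ} (hd : 0 < d) (h : ¬ a ∣ d) (r : ℤ) :
    Nat.card (eulerFactorisations a d r) = 0 := by
  have : IsEmpty (eulerFactorisations a d r) := ⟨fun x => by
    obtain ⟨k, g, hk, -⟩ := exists_genus hd x.2.2
    exact h ⟨k, by rw [← hk, mul_comm]⟩⟩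
  exact Nat.card_of_isEmpty

/-! ### The exponential formula for generating series -/

/-- The generating series in `ħ` of all monotone data in degree `d`. -/
noncomputable def totalSeries (a d : ℕ) : PowerSeries ℚ :=
  PowerSeries.mk fun m => (Nat.card (monotoneData a m (Fin d)) : ℚ)

/-- The generating series in `ħ` of the connected monotone data in degree `d`. -/
noncomputable def connectedSeries (a d : ℕ) : PowerSeries ℚ :=
  PowerSeries.mk fun m => (Nat.card (connectedData a m (Fin d)) : ℚ)

/-- The normalisation `ħ^{-d/a} / d!` of the generating series in degree `d`. The quotient `d / a`
is rounded, but the series vanish unless `a` divides `d`. -/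
noncomputable def normalise (a d : ℕ) (f : PowerSeries ℚ) : LaurentSeries ℚ :=
  HahnSeries.ofPowerSeries ℤ ℚ f / (hbar ^ (d / a) * (d.factorial : LaurentSeries ℚ))

theorem totalSeries_succ (a d : ℕ) :
    totalSeries a (d + 1) = ∑ i ∈ Finset.range (d + 1),
      (d.choose i : PowerSeries ℚ) * (connectedSeries a (i + 1) * totalSeries a (d - i)) := by
  ext m
  rw [totalSeries, PowerSeries.coeff_mk, card_monotoneData_succ, map_sum, Nat.cast_sum]
  refine Finset.sum_congr rfl fun i _ => ?_
  rw [← map_natCast (PowerSeries.C (R := ℚ)), PowerSeries.coeff_C_mul, PowerSeries.coeff_mul,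
    Nat.cast_mul, Nat.cast_sum]
  simp only [connectedSeries, totalSeries, PowerSeries.coeff_mk, Nat.cast_mul]

theorem totalSeries_of_not_dvd {a d : ℕ} (h : ¬ a ∣ d) : totalSeries a d = 0 := by
  ext m
  rw [totalSeries, PowerSeries.coeff_mk, card_monotoneData_of_not_dvd h, Nat.cast_zero, map_zero]

theorem connectedSeries_of_not_dvd {a d : ℕ} (h : ¬ a ∣ d) : connectedSeries a d = 0 := by
  ext m
  have := card_connectedData_le (a := a) (m := m) (d := d)
  rw [card_monotoneData_of_not_dvd h, Nat.le_zero] at this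
  rw [connectedSeries, PowerSeries.coeff_mk, this, Nat.cast_zero, map_zero]

theorem totalSeries_eq (a d : ℕ) :
    totalSeries a d = (Nat.card {σ : Perm (Fin d) // UniformCycles a σ} : PowerSeries ℚ) *
      ∏ s : Fin d, PowerSeries.mk fun l => ((s : ℕ) : ℚ) ^ l := by
  ext m
  rw [totalSeries, PowerSeries.coeff_mk, card_monotoneData_fin,
    ← map_natCast (PowerSeries.C (R := ℚ)), PowerSeries.coeff_C_mul]

theorem hbar_ne_zero : hbar ≠ 0 :=
  HahnSeries.single_ne_zero one_ne_zero

instance charZero_laurentSeries : CharZero (LaurentSeries ℚ) :=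
  algebraRat.charZero _

theorem inv_hbar_pow (k : ℕ) : (hbar ^ k)⁻¹ = HahnSeries.single (-(k : ℤ)) (1 : ℚ) := by
  rw [hbar, ← RatFunc.single_one_eq_pow, HahnSeries.inv_single, inv_one]

theorem coeff_normalise (a d : ℕ) (f : PowerSeries ℚ) (r : ℤ) :
    (normalise a d f).coeff r = 1 / (d.factorial : ℚ) *
      if r + (d / a : ℕ) < 0 then 0 else PowerSeries.coeff (r + (d / a : ℕ)).natAbs f := by
  have hC : ((d.factorial : LaurentSeries ℚ))⁻¹ =
      HahnSeries.single 0 (1 / (d.factorial : ℚ)) := by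
    rw [← map_natCast (HahnSeries.C (Γ := ℤ) (R := ℚ)), HahnSeries.C_apply, HahnSeries.inv_single,
      neg_zero, one_div]
  rw [normalise, div_eq_mul_inv, mul_inv, mul_comm, inv_hbar_pow, hC, HahnSeries.single_mul_single,
    HahnSeries.coeff_single_mul, PowerSeries.coeff_coe, one_mul, add_zero, sub_neg_eq_add]

theorem coeff_exponent {a d : ℕ} (ha : 1 ≤ a) (hd : 0 < d) :
    PowerSeries.coeff d (exponent a) = normalise a d (connectedSeries a d) := by
  ext r
  rw [coeff_coeff_exponent hd, coeff_normalise]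
  by_cases h : a ∣ d
  · obtain ⟨k, rfl⟩ := h
    rw [card_eulerFactorisations ha, Nat.mul_div_cancel_left _ ha, connectedSeries,
      PowerSeries.coeff_mk, Nat.cast_ite, Nat.cast_zero]
  · rw [card_eulerFactorisations_of_not_dvd hd h, connectedSeries_of_not_dvd h, map_zero, ite_self,
      Nat.cast_zero]

theorem constantCoeff_exponent (a : ℕ) : PowerSeries.constantCoeff (exponent a) = 0 := by
  have hzero : ∀ (g : ℕ) (n : ℕ+), PowerSeries.coeff 0 (diagFreeEnergy a g n) = 0 := by
    intro g n
    have : IsEmpty {x : eulerFactorisations a 0 (2 * g - 2 + (n : ℕ)) // numCycles x.1 = n} :=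
      ⟨fun x => by
        have h1 : numCycles x.1.1 = 0 := by
          have : IsEmpty (Quotient (Perm.SameCycle.setoid (x.1.1.1 * x.1.1.2.prod))) :=
            ⟨fun c => Quotient.inductionOn c fun y => y.elim0⟩
          exact Nat.card_of_isEmpty
        exact n.ne_zero (x.2.symm.trans h1)⟩
    rw [coeff_diagFreeEnergy, Nat.card_of_isEmpty, Nat.cast_zero, mul_zero]
  rw [← PowerSeries.coeff_zero_eq_constantCoeff_apply, exponent, PowerSeries.coeff_mk]
  ext r
  rw [HahnSeries.SummableFamily.coeff_hsum]
  refine finsum_eq_zero_of_forall_eq_zero fun p => ?_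
  change (HahnSeries.single _ (1 / ((p.2 : ℕ).factorial : ℚ) *
    PowerSeries.coeff 0 (diagFreeEnergy a p.1 p.2))).coeff r = 0
  rw [hzero, mul_zero, map_zero, HahnSeries.coeff_zero]

/-- A power series is determined by its logarithmic derivative and its constant coefficient. -/
theorem eq_of_derivative_eq_mul {K : Type*} [Field K] [CharZero K] {G W Z : PowerSeries K}
    (hW : PowerSeries.derivative K W = G * W) (hZ : PowerSeries.derivative K Z = G * Z)
    (h0 : PowerSeries.coeff 0 W = PowerSeries.coeff 0 Z) : W = Z := by
  ext n
  induction n using Nat.strong_induction_on with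
  | _ n ih =>
    cases n with
    | zero => exact h0
    | succ n =>
      have h1 := congrArg (PowerSeries.coeff n) hW
      have h2 := congrArg (PowerSeries.coeff n) hZ
      rw [PowerSeries.coeff_derivative, PowerSeries.coeff_mul] at h1 h2
      have h3 : ∑ p ∈ antidiagonal n, PowerSeries.coeff p.1 G * PowerSeries.coeff p.2 W =
          ∑ p ∈ antidiagonal n, PowerSeries.coeff p.1 G * PowerSeries.coeff p.2 Z :=
        Finset.sum_congr rfl fun p hp => by
          rw [ih p.2 (by have := mem_antidiagonal.1 hp; omega)]
      exact mul_right_cancel₀ (Nat.cast_add_one_ne_zero n) (h1.trans (h3.trans h2.symm))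

/-- The wave function is the generating series of all monotone data, connected or not. -/
theorem waveFunction_eq {a : ℕ} (ha : 1 ≤ a) :
    waveFunction a = PowerSeries.mk fun d => normalise a d (totalSeries a d) := by
  have hs : PowerSeries.HasSubst (exponent a) :=
    PowerSeries.HasSubst.of_constantCoeff_zero' (constantCoeff_exponent a)
  refine eq_of_derivative_eq_mul (G := PowerSeries.derivative _ (exponent a)) ?_ ?_ ?_
  · rw [waveFunction, PowerSeries.derivative_subst hs, PowerSeries.derivative_exp, mul_comm]
  · ext1 d
    rw [PowerSeries.coeff_derivative, PowerSeries.coeff_mul,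
      Finset.Nat.sum_antidiagonal_eq_sum_range_succ_mk, PowerSeries.coeff_mk, normalise,
      totalSeries_succ, map_sum, Finset.sum_div, Finset.sum_mul]
    refine Finset.sum_congr rfl fun i hi => ?_
    have hid : i ≤ d := Nat.lt_succ_iff.1 (Finset.mem_range.1 hi)
    simp only
    rw [PowerSeries.coeff_derivative, coeff_exponent ha i.succ_pos, PowerSeries.coeff_mk]
    by_cases h1 : a ∣ i + 1
    · by_cases h2 : a ∣ d - i
      · have hdiv : (d + 1) / a = (i + 1) / a + (d - i) / a := by
          rw [← Nat.add_div_of_dvd_right h1]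
          congr 1
          omega
        have hfac : ((d + 1).factorial : LaurentSeries ℚ) =
            (d + 1) * (d.choose i * i.factorial * (d - i).factorial) := by
          rw [Nat.factorial_succ, ← Nat.choose_mul_factorial_mul_factorial hid]
          push_cast
          ring
        have hfac' : ((i + 1).factorial : LaurentSeries ℚ) = (i + 1) * i.factorial := by
          rw [Nat.factorial_succ]
          push_cast
          ring
        have e1 : (d + 1 : LaurentSeries ℚ) ≠ 0 := Nat.cast_add_one_ne_zero d
        have e2 : (i + 1 : LaurentSeries ℚ) ≠ 0 := Nat.cast_add_one_ne_zero i
        have e3 : (d.choose i : LaurentSeries ℚ) ≠ 0 :=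
          Nat.cast_ne_zero.2 (Nat.choose_pos hid).ne'
        have e4 : (i.factorial : LaurentSeries ℚ) ≠ 0 := Nat.cast_ne_zero.2 i.factorial_ne_zero
        have e5 : ((d - i).factorial : LaurentSeries ℚ) ≠ 0 :=
          Nat.cast_ne_zero.2 (d - i).factorial_ne_zero
        have e6 := hbar_ne_zero
        rw [normalise, normalise, map_mul, map_mul, map_natCast, hdiv, hfac, hfac', pow_add]
        generalize HahnSeries.ofPowerSeries ℤ ℚ (connectedSeries a (i + 1)) = A
        generalize HahnSeries.ofPowerSeries ℤ ℚ (totalSeries a (d - i)) = B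
        field_simp
      · rw [totalSeries_of_not_dvd h2]
        simp [normalise]
    · rw [connectedSeries_of_not_dvd h1]
      simp [normalise]
  · rw [waveFunction, PowerSeries.coeff_subst' hs, finsum_eq_single _ 0]
    · have hN := card_uniformCycles_mul (α := Fin 0) (a := a) (k := 0) ha (by simp)
      rw [pow_zero, Nat.factorial_zero, mul_one, mul_one, mul_zero, Nat.factorial_zero] at hN
      rw [PowerSeries.coeff_mk, normalise, totalSeries_eq, hN]
      simp
    · intro n hn
      rw [PowerSeries.coeff_zero_eq_constantCoeff_apply, map_pow, constantCoeff_exponent,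
        zero_pow hn, smul_zero]

/-! ### The closed formula and the quantum curve -/

theorem one_sub_mul_hbar_ne_zero (j : ℕ) : 1 - (j : LaurentSeries ℚ) * hbar ≠ 0 := by
  intro h
  have h1 := congrArg (fun f : LaurentSeries ℚ => f.coeff 0) h
  rw [← map_natCast (HahnSeries.C (Γ := ℤ) (R := ℚ)), HahnSeries.C_apply, hbar,
    HahnSeries.single_mul_single] at h1
  simp [HahnSeries.coeff_single_of_ne] at h1

theorem ofPowerSeries_geometric (s : ℕ) :
    HahnSeries.ofPowerSeries ℤ ℚ (PowerSeries.mk fun l => (s : ℚ) ^ l) =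
      1 / (1 - (s : LaurentSeries ℚ) * hbar) := by
  have h : (PowerSeries.mk fun l => (s : ℚ) ^ l) *
      (1 - (s : PowerSeries ℚ) * PowerSeries.X) = 1 := by
    ext n
    rw [mul_sub, mul_one, map_sub, ← mul_assoc, mul_comm _ (s : PowerSeries ℚ), mul_assoc,
      ← map_natCast (PowerSeries.C (R := ℚ)), PowerSeries.coeff_C_mul]
    cases n with
    | zero => simp
    | succ n =>
      rw [PowerSeries.coeff_succ_mul_X, PowerSeries.coeff_mk, PowerSeries.coeff_mk, pow_succ',
        sub_self, PowerSeries.coeff_one, if_neg n.succ_ne_zero]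
  rw [eq_div_iff (one_sub_mul_hbar_ne_zero s)]
  have h2 := congrArg (HahnSeries.ofPowerSeries ℤ ℚ) h
  rwa [map_mul, map_sub, map_one, map_mul, map_natCast, HahnSeries.ofPowerSeries_X] at h2

theorem coeff_waveFunction_mul {a : ℕ} (ha : 1 ≤ a) (k : ℕ) :
    PowerSeries.coeff (a * k) (waveFunction a) =
      1 / ((k.factorial : LaurentSeries ℚ) * (a : LaurentSeries ℚ) ^ k * hbar ^ k) *
        ∏ j ∈ Finset.range (a * k), 1 / (1 - (j : LaurentSeries ℚ) * hbar) := by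
  have hN : (Nat.card {σ : Perm (Fin (a * k)) // UniformCycles a σ} : LaurentSeries ℚ) *
      (k.factorial * a ^ k) = (a * k).factorial := by
    exact_mod_cast card_uniformCycles_mul ha (Fintype.card_fin (a * k))
  have e1 : (k.factorial : LaurentSeries ℚ) ≠ 0 := Nat.cast_ne_zero.2 k.factorial_ne_zero
  have e2 : (a : LaurentSeries ℚ) ≠ 0 := Nat.cast_ne_zero.2 (by omega)
  have e3 : ((a * k).factorial : LaurentSeries ℚ) ≠ 0 :=
    Nat.cast_ne_zero.2 (a * k).factorial_ne_zero
  have e4 := hbar_ne_zero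
  rw [waveFunction_eq ha, PowerSeries.coeff_mk, normalise, totalSeries_eq, map_mul, map_natCast,
    map_prod, Finset.prod_congr rfl fun (s : Fin (a * k)) _ => ofPowerSeries_geometric s,
    Fin.prod_univ_eq_prod_range (fun j => 1 / (1 - (j : LaurentSeries ℚ) * hbar)) (a * k),
    Nat.mul_div_cancel_left _ ha]
  generalize ∏ j ∈ Finset.range (a * k), 1 / (1 - (j : LaurentSeries ℚ) * hbar) = A
  rw [← hN] at e3 ⊢
  have e5 := left_ne_zero_of_mul e3
  field_simp

theorem coeff_waveFunction_of_not_dvd {a d : ℕ} (ha : 1 ≤ a) (h : ¬ a ∣ d) :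
    PowerSeries.coeff d (waveFunction a) = 0 := by
  rw [waveFunction_eq ha, PowerSeries.coeff_mk, totalSeries_of_not_dvd h, normalise, map_zero,
    zero_div]

theorem coeff_yHat (f : PowerSeries (LaurentSeries ℚ)) (n : ℕ) :
    PowerSeries.coeff n (yHat f) = -hbar * (n + 1) * PowerSeries.coeff (n + 1) f := by
  change PowerSeries.coeff n ((-hbar) • PowerSeries.derivative _ f) = _
  rw [PowerSeries.coeff_smul, PowerSeries.coeff_derivative, smul_eq_mul]
  ring

theorem coeff_xHat_yHat (f : PowerSeries (LaurentSeries ℚ)) (n : ℕ) :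
    PowerSeries.coeff n ((xHat * yHat) f) = -hbar * n * PowerSeries.coeff n f := by
  change PowerSeries.coeff n (PowerSeries.X * yHat f) = _
  cases n with
  | zero => simp
  | succ n => rw [PowerSeries.coeff_succ_X_mul, coeff_yHat, Nat.cast_succ]

/-- The factors of the quantum curve are diagonal in the monomial basis. -/
theorem coeff_prod_factors (l : List ℕ) (f : PowerSeries (LaurentSeries ℚ)) (n : ℕ) :
    PowerSeries.coeff n ((l.map fun j : ℕ =>
      1 + xHat * yHat + ((j : LaurentSeries ℚ) * hbar) •
        (1 : Module.End (LaurentSeries ℚ) (PowerSeries (LaurentSeries ℚ)))).prod f) =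
      (l.map fun j : ℕ => 1 - (n : LaurentSeries ℚ) * hbar + j * hbar).prod *
        PowerSeries.coeff n f := by
  induction l with
  | nil => simp
  | cons j l ih =>
    rw [List.map_cons, List.prod_cons, List.map_cons, List.prod_cons, mul_assoc, ← ih,
      Module.End.mul_apply]
    generalize ((l.map fun j : ℕ => 1 + xHat * yHat + ((j : LaurentSeries ℚ) * hbar) •
        (1 : Module.End (LaurentSeries ℚ) (PowerSeries (LaurentSeries ℚ)))).prod f) = h
    rw [LinearMap.add_apply, LinearMap.add_apply, LinearMap.smul_apply, Module.End.one_apply,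
      map_add, map_add, coeff_xHat_yHat, PowerSeries.coeff_smul, smul_eq_mul]
    ring

theorem coeff_xHat_pow (f : PowerSeries (LaurentSeries ℚ)) (b n : ℕ) :
    PowerSeries.coeff n ((xHat ^ b) f) =
      if b ≤ n then PowerSeries.coeff (n - b) f else 0 := by
  rw [← PowerSeries.coeff_X_pow_mul', xHat, LinearMap.pow_mulLeft]
  rfl

theorem quantumCurve_waveFunction {a : ℕ} (ha : 1 ≤ a) : quantumCurve a (waveFunction a) = 0 := by
  ext1 n
  rw [quantumCurve, LinearMap.add_apply, map_add, coeff_xHat_pow, Module.End.mul_apply,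
    coeff_prod_factors, coeff_yHat, map_zero]
  by_cases h : a ∣ n + 1
  · obtain ⟨k, hk⟩ := h
    cases k with
    | zero => omega
    | succ k =>
      rw [Nat.mul_succ] at hk
      have hn : n - (a - 1) = a * k := by omega
      rw [if_pos (by omega), hn, hk, ← Nat.mul_succ, coeff_waveFunction_mul ha,
        coeff_waveFunction_mul ha, Nat.mul_succ, Finset.prod_range_add]
      have hcast : (n : LaurentSeries ℚ) + 1 = a * (k + 1) := by
        exact_mod_cast (hk.trans (Nat.mul_succ a k).symm)
      -- the factor for `j` cancels the factor `1 / (1 - (n - j) ħ)` of the coefficient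
      have hprod : ((List.range a).map fun j : ℕ =>
          1 - (n : LaurentSeries ℚ) * hbar + j * hbar).prod =
            ∏ i ∈ Finset.range a, (1 - ((a * k + i : ℕ) : LaurentSeries ℚ) * hbar) := by
        rw [← Finset.prod_range_reflect]
        refine (Finset.prod_congr rfl fun j hj => ?_ : ∏ j ∈ Finset.range a,
          (1 - (n : LaurentSeries ℚ) * hbar + j * hbar) = _)
        have hj' := Finset.mem_range.1 hj
        have : (n : LaurentSeries ℚ) = (a * k + (a - 1 - j) : ℕ) + j := by
          exact_mod_cast (by omega : n = a * k + (a - 1 - j) + j)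
        rw [this]
        ring
      have hcancel : (∏ i ∈ Finset.range a, (1 - ((a * k + i : ℕ) : LaurentSeries ℚ) * hbar)) *
          ∏ i ∈ Finset.range a, 1 / (1 - ((a * k + i : ℕ) : LaurentSeries ℚ) * hbar) = 1 := by
        rw [← Finset.prod_mul_distrib]
        exact Finset.prod_eq_one fun i _ => mul_one_div_cancel (one_sub_mul_hbar_ne_zero _)
      rw [hprod, hcast]
      generalize (∏ i ∈ Finset.range a, (1 - ((a * k + i : ℕ) : LaurentSeries ℚ) * hbar)) = A
        at hcancel ⊢
      generalize (∏ i ∈ Finset.range a, 1 / (1 - ((a * k + i : ℕ) : LaurentSeries ℚ) * hbar)) = B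
        at hcancel ⊢
      generalize ∏ j ∈ Finset.range (a * k), 1 / (1 - (j : LaurentSeries ℚ) * hbar) = C
      have e1 : (k.factorial : LaurentSeries ℚ) ≠ 0 := Nat.cast_ne_zero.2 k.factorial_ne_zero
      have e2 : (a : LaurentSeries ℚ) ≠ 0 := Nat.cast_ne_zero.2 (by omega)
      have e3 : (k + 1 : LaurentSeries ℚ) ≠ 0 := Nat.cast_add_one_ne_zero k
      have e4 := hbar_ne_zero
      rw [Nat.factorial_succ, Nat.cast_mul, Nat.cast_succ, pow_succ, pow_succ]
      field_simp
      linear_combination (-C) * hcancel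
  · rw [coeff_waveFunction_of_not_dvd ha h, mul_zero, mul_zero, add_zero]
    split_ifs with hle
    · refine coeff_waveFunction_of_not_dvd ha fun h' => h ?_
      rw [show n + 1 = n - (a - 1) + a by omega]
      exact h'.add (dvd_refl a)
    · rfl

end MonotoneOrbifold

theorem theorem2 (a : ℕ) (ha : 1 ≤ a) :
    -- the wave function is `1 + ∑_{k ≥ 1} x^{ak} / (k! a^k ħ^k) * ∏_{j=1}^{ak-1} 1 / (1 - j ħ)`
    (MonotoneOrbifold.waveFunction a =
      1 + PowerSeries.expand a (Nat.one_le_iff_ne_zero.mp ha) (PowerSeries.mk fun k : ℕ =>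
        if k = 0 then 0 else
          1 / ((Nat.factorial k : LaurentSeries ℚ) * (a : LaurentSeries ℚ) ^ k *
              MonotoneOrbifold.hbar ^ k) *
            ∏ j ∈ Finset.Icc 1 (a * k - 1),
              1 / (1 - (j : LaurentSeries ℚ) * MonotoneOrbifold.hbar))) ∧
    -- the quantum curve annihilates the wave function
    MonotoneOrbifold.quantumCurve a (MonotoneOrbifold.waveFunction a) = 0 := by
  refine ⟨?_, MonotoneOrbifold.quantumCurve_waveFunction ha⟩
  ext1 d
  rw [map_add, PowerSeries.coeff_one, PowerSeries.coeff_expand]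
  by_cases h : a ∣ d
  · obtain ⟨k, rfl⟩ := h
    rw [MonotoneOrbifold.coeff_waveFunction_mul ha, if_pos (dvd_mul_right a k),
      Nat.mul_div_cancel_left _ ha, PowerSeries.coeff_mk]
    rcases Nat.eq_zero_or_pos k with rfl | hk
    · simp
    · have hak : 0 < a * k := Nat.mul_pos ha hk
      rw [if_neg hak.ne', if_neg hk.ne', zero_add]
      congr 1
      -- the factor for `j = 0` is `1`
      rw [Finset.prod_range_eq_mul_Ico _ hak, Nat.cast_zero, zero_mul, sub_zero, div_one, one_mul]
      refine Finset.prod_congr (Finset.ext fun j => ?_) fun _ _ => rfl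
      rw [Finset.mem_Ico, Finset.mem_Icc]
      omega
  · rw [MonotoneOrbifold.coeff_waveFunction_of_not_dvd ha h, if_neg h, if_neg, add_zero]
    rintro rfl
    exact h (dvd_zero a)
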